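/- \textbf{Structural correspondence.} Processes are those of the finite $\pi$-calculus, $P ::= \mathbf 0 \mid \overline b a.P \mid b(x).P \mid P\,|\,P \mid \nu a(P)$, over disjoint infinite sets of names and variables, with channels $b$ and objects $a$ that are names or variables. As usual, all bound names and variables of the initial process are pairwise distinct and distinct from its free ones. \emph{Reversible processes} decorate channels with instantiators ($*$ initially), keep executed prefixes $\alpha[i,K].X$ with a key $i$ and a contextual cause set $K$ (a set of keys and $*$), and decorate restrictions $\nu a_{\Gamma_w}$ with a set of keys $\Gamma$ indexed by $w$, a key or $*$ ($\emptyset_*$ initially; empty iff $\Gamma=\emptyset$ and $w=*$). Their forward transitions $X\to^{\mu} X'$, $\mu=(i,K,j):\pi$, with $\pi$ of the form $\overline b a$, $b(x)$, $\overline b\langle\nu a_{\Gamma_w}\rangle$ or $\tau$, are those of the parametric framework for reversible $\pi$-calculi (rules Out, In, Par, Res, Com, Cause Ref, Open, Close) in which an executed prefix lets through every action of its continuation with a key fresh for the whole process, an empty restriction $\nu a$ does not let out $a$ on the channel $a$ itself, both predicates $\mathrm{Cause}(\Gamma_w,K,K')$ and $\mathrm{Update}(\Gamma_w,K,K')$ mean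 $K'=K\cup\{w\}$, and $\Gamma_w+i$ is $(\Gamma\cup\{i\})_i$ if $w=*$ and $(\Gamma\cup\{i\})_w$ otherwise. Erasing $\varphi$ deletes executed prefixes, decorations, and the restrictions with non-empty memory. \emph{Causal processes} $A ::= P\mid \mathtt K::A\mid A\,|\,A\mid \nu a(A)$ have the Boreale--Sangiorgi causal transitions in late style, $A\to^{K_B}_{\zeta}A'$, where $\zeta$ is $k:\pi$ ($\pi$ an input, a free or a bound output; $k$ a key) or $\tau$. An executed prefix $\alpha.P$ becomes $\{k\}::P$ with cause set $\emptyset$, every enclosing $\mathtt K::$ adds $\mathtt K$ to the cause set, and a synchronisation of two actions with fresh key $k$ and cause sets $K_1,K_2$ replaces $k$ by $K_2$ in the cause sets of the first residual and by $K_1$ in those of the second. For $\zeta=k:\pi$, $K_B$ is the cause set of the action; a silent label shows no causes, and for $\zeta=\tau$, $K_B$ denotes the union of the cause sets of the two synchronising actions. Erasing $\lambda$ deletes all $\mathtt K::$. The function $\gamma$ maps $(i,K,j):\tau$ to $\tau$ and $(i,K,j):\pi$ to $i:\gamma(\pi)$ if $\pi\ne\tau$, where $\gamma$ is the identity on $\overline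 b a$ and $b(x)$, and $\gamma(\overline b\langle\nu a_{\Gamma_w}\rangle)$ is the bound output $\overline b(a)$ if $\Gamma_w$ is empty and the free output $\overline b a$ otherwise. For a transition $X\to^{\mu}X'$ with key $i$, let $G$ be the directed graph whose vertices are the occurrences of executed prefixes of $X'$, named by their keys, with an edge from each prefix to the prefixes in its scope, and edges in both directions between different vertices with the same key. Let $G(i)$ be the subgraph of all paths that end in a vertex with key $i$. $K_F$ is the multiset of the keys other than $i$ of the vertices of $G(i)$, and $\mathtt{Rem}(K_F)$ is the set of those keys of $K_F$ that are still names of vertices after all bidirectional edges of $G(i)$ have been contracted to fresh vertices $\tau_l$. Write $X\to^{\mu}_{K_F}X'$. Let $P$ be an initial $\pi$-calculus process, $n\ge 0$, and let $A_1$ and $X_1$ be $P$, seen as a causal process and as a reversible process. \begin{enumerate} \item If $A_1\to^{K_{B1}}_{\zeta_1}A_2\cdots A_n\to^{K_{Bn}}_{\zeta_n}A_{n+1}$, then there is a trace $X_1\to^{\mu_1}_{K_{F1}}X_2\cdots X_n\to^{\mu_n}_{K_{Fn}}X_{n+1}$ such that $\lambda(A_i)=\varphi(X_i)$ for $1\le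 i\le n+1$, and $\zeta_i=\gamma(\mu_i)$ and $\mathtt{Rem}(K_{Fi})=K_{Bi}$ for $1\le i\le n$. \item Conversely, if $X_1\to^{\mu_1}_{K_{F1}}X_2\cdots X_n\to^{\mu_n}_{K_{Fn}}X_{n+1}$, then there is a trace $A_1\to^{K_{B1}}_{\zeta_1}A_2\cdots A_n\to^{K_{Bn}}_{\zeta_n}A_{n+1}$ such that $\lambda(A_i)=\varphi(X_i)$ for $1\le i\le n+1$, and $\zeta_i=\gamma(\mu_i)$ and $\mathtt{Rem}(K_{Fi})=K_{Bi}$ for $1\le i\le n$. \end{enumerate} -/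

import Mathlib

namespace PiCausal

/-! ## Names, variables, keys -/

abbrev Name := ℕ
abbrev Var := ℕ
abbrev Key := ℕ

/-- Keys extended with the special key `*`, which is `none`. -/
abbrev SKey := Option Key

/-- What may stand in subject or output-object position: a name or a variable. -/
inductive Atom : Type
  | name (a : Name)
  | var (x : Var)

/-- An atom decorated with its instantiator. -/
abbrev DAtom := Atom × SKey

open Classical in
/-- Replaces the variable `x` by `v`. -/
noncomputable def Atom.replace (x : Var) (v c : Atom) : Atom :=
  if c = .var x then v else c

open Classical in
/-- Replaces the variable `x` by `v`, decorated with the instantiator `i`. -/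
noncomputable def replaceD (x : Var) (v : Atom) (i : Key) (c : DAtom) : DAtom :=
  if c.1 = .var x then (v, some i) else c

/-! ## π-calculus processes -/

/-- π-calculus syntax over a type `α` of channels: `Proc Atom` are the π-calculus processes and
`Proc DAtom` are the processes whose channels are decorated with instantiators. -/
inductive Proc (α : Type) : Type
  | nil
  | out (b a : α) (P : Proc α)
  | inp (b : α) (x : Var) (P : Proc α)
  | par (P Q : Proc α)
  | res (a : Name) (P : Proc α)

namespace Proc

def map {α β : Type} (f : α → β) : Proc α → Proc β
  | nil => nil
  | out b a P => out (f b) (f a) (P.map f)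
  | inp b x P => inp (f b) x (P.map f)
  | par P Q => par (P.map f) (Q.map f)
  | res a P => res a (P.map f)

/-- Applies `f` to every channel occurrence outside the scope of the input binders of `x`. -/
def substBy {α : Type} (x : Var) (f : α → α) : Proc α → Proc α
  | nil => nil
  | out b a P => out (f b) (f a) (P.substBy x f)
  | inp b y P => inp (f b) y (if y = x then P else P.substBy x f)
  | par P Q => par (P.substBy x f) (Q.substBy x f)
  | res a P => res a (P.substBy x f)

/-- The substitution `P{v/x}`. It is used only on processes in which no capture can occur. -/
noncomputable def subst (P : Proc Atom) (x : Var) (v : Atom) : Proc Atom :=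
  P.substBy x (Atom.replace x v)

/-- Free names and free variables. -/
def free : Proc Atom → Set Atom
  | nil => ∅
  | out b a P => {b, a} ∪ P.free
  | inp b x P => {b} ∪ (P.free \ {.var x})
  | par P Q => P.free ∪ Q.free
  | res a P => P.free \ {.name a}

/-- The list of all binders of a process. -/
def binders : Proc Atom → List Atom
  | nil => []
  | out _ _ P => P.binders
  | inp _ x P => .var x :: P.binders
  | par P Q => P.binders ++ Q.binders
  | res a P => .name a :: P.binders

/-- The usual convention on bound names and variables: they are pairwise distinct, and distinct
from the free ones. There is no replication, hence binders are never copied and α-conversion is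
never needed in a computation that starts from such a process. -/
def BoundDistinct (P : Proc Atom) : Prop :=
  P.binders.Nodup ∧ ∀ c ∈ P.binders, c ∉ P.free

end Proc

/-! ## The memory of a restriction: indexed sets of keys -/

/-- An indexed set `Γ_w`. -/
structure Mem : Type where
  set : Set Key
  idx : SKey

namespace Mem

/-- `∅_*` -/
def init : Mem := ⟨∅, none⟩

def Empty (δ : Mem) : Prop := δ.set = ∅ ∧ δ.idx = none

/-- `Γ_w + i` -/
def add (δ : Mem) (i : Key) : Mem :=
  ⟨insert i δ.set, match δ.idx with
    | none => some i
    | some w => some w⟩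

open Classical in
/-- The action of `#i` on a memory: the index `i` is reset to `*`. -/
noncomputable def sharp (δ : Mem) (i : Key) : Mem :=
  if δ.idx = some i then ⟨δ.set, none⟩ else δ

/-- The predicate `Cause(Γ_w, K, K')` of the instance. -/
def Cause (δ : Mem) (K K' : Set SKey) : Prop := K' = K ∪ {δ.idx}

/-- The predicate `Update(Γ_w, K, K')` of the instance. -/
def Update (δ : Mem) (K K' : Set SKey) : Prop := K' = K ∪ {δ.idx}

end Mem

/-! ## Reversible processes of the framework -/

/-- Reversible processes. Constructors `pastOut` and `pastInp` are executed prefixes, with their key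
`i` and contextual cause set `K`. A decorated standard process is a term without executed prefixes
all of whose restrictions carry the initial memory (see `ofProc`). -/
inductive RProc : Type
  | nil
  | out (b a : DAtom) (P : Proc DAtom)
  | inp (b : DAtom) (x : Var) (P : Proc DAtom)
  | pastOut (b a : DAtom) (i : Key) (K : Set SKey) (X : RProc)
  | pastInp (b : DAtom) (x : Var) (i : Key) (K : Set SKey) (X : RProc)
  | par (X Y : RProc)
  | res (a : Name) (δ : Mem) (X : RProc)

namespace RProc

/-- A decorated π-calculus process as a reversible process. -/
def ofProc : Proc DAtom → RProc
  | .nil => nil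
  | .out b a P => out b a P
  | .inp b x P => inp b x P
  | .par P Q => par (ofProc P) (ofProc Q)
  | .res a P => res a Mem.init (ofProc P)

/-- The initial reversible process of `P`: all restrictions are initialised and all names and
variables are decorated with `*`. -/
def initial (P : Proc Atom) : RProc := ofProc (P.map fun c => (c, none))

open Classical in
/-- The erasing function `φ`. -/
noncomputable def erase : RProc → Proc Atom
  | nil => .nil
  | out b a P => .out b.1 a.1 (P.map Prod.fst)
  | inp b x P => .inp b.1 x (P.map Prod.fst)
  | pastOut _ _ _ _ X => X.erase
  | pastInp _ _ _ _ X => X.erase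
  | par X Y => .par X.erase Y.erase
  | res a δ X => if δ.Empty then .res a X.erase else X.erase

/-- The set `key(X)` of communication keys. -/
def keys : RProc → Set Key
  | nil => ∅
  | out _ _ _ => ∅
  | inp _ _ _ => ∅
  | pastOut _ _ i _ X => {i} ∪ X.keys
  | pastInp _ _ i _ X => {i} ∪ X.keys
  | par X Y => X.keys ∪ Y.keys
  | res _ _ X => X.keys

/-- The substitution `X{v^i/x}`. An executed input no longer binds its variable. -/
noncomputable def subst (x : Var) (v : Atom) (i : Key) : RProc → RProc
  | nil => nil
  | out b a P => out (replaceD x v i b) (replaceD x v i a) (P.substBy x (replaceD x v i))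
  | inp b y P =>
      inp (replaceD x v i b) y (if y = x then P else P.substBy x (replaceD x v i))
  | pastOut b a k K X => pastOut (replaceD x v i b) (replaceD x v i a) k K (X.subst x v i)
  | pastInp b y k K X => pastInp (replaceD x v i b) y k K (X.subst x v i)
  | par X Y => par (X.subst x v i) (Y.subst x v i)
  | res a δ X => res a δ (X.subst x v i)

open Classical in
/-- The contextual cause update of the action with key `i`, from `K` to `K'`. -/
noncomputable def updateCause (i : Key) (K K' : Set SKey) : RProc → RProc
  | nil => nil
  | out b a P => out b a P
  | inp b x P => inp b x P
  | pastOut b a k L X =>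
      pastOut b a k (if k = i ∧ L = K then K' else L) (X.updateCause i K K')
  | pastInp b x k L X =>
      pastInp b x k (if k = i ∧ L = K then K' else L) (X.updateCause i K K')
  | par X Y => par (X.updateCause i K K') (Y.updateCause i K K')
  | res a δ X => res a δ (X.updateCause i K K')

/-- The operation `X_{#i}`. -/
noncomputable def sharp (i : Key) : RProc → RProc
  | nil => nil
  | out b a P => out b a P
  | inp b x P => inp b x P
  | pastOut b a k K X => pastOut b a k K (X.sharp i)
  | pastInp b x k K X => pastInp b x k K (X.sharp i)
  | par X Y => par (X.sharp i) (Y.sharp i)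
  | res a δ X => res a (δ.sharp i) (X.sharp i)

end RProc

/-! ## Forward transitions of the framework -/

/-- Actions `π` of the framework; `bout b a δ` is the output of `a`, restricted with memory `δ`. -/
inductive FAct : Type
  | out (b a : Atom)
  | inp (b : Atom) (x : Var)
  | bout (b : Atom) (a : Name) (δ : Mem)
  | tau

namespace FAct

/-- The subject of an action (none for a silent one). -/
def sub : FAct → Set Atom
  | out b _ => {b}
  | inp b _ => {b}
  | bout b _ _ => {b}
  | tau => ∅

/-- The names and variables that occur in an action. -/
def atoms : FAct → Set Atom
  | out b a => {b, a}
  | inp b x => {b, .var x}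
  | bout b a _ => {b, .name a}
  | tau => ∅

end FAct

/-- Labels `(i, K, j) : π` of the framework. -/
structure FLabel : Type where
  key : Key
  ctx : Set SKey
  inst : SKey
  act : FAct

/-- `K =_* j` -/
def StarEq (K : Set SKey) (j : SKey) : Prop := none ∈ K ∨ j = none ∨ K = {j}

/-- The forward transitions `X --(i,K,j):π--> X'` of the framework with memories `Γ_w`. The rules for
parallel composition come with their symmetric versions, and an executed prefix lets through every
action of its continuation. A restriction with empty memory is a binder, so it lets out
its name only on a different channel. -/
inductive FStep : RProc → FLabel → RProc → Prop
  | out1 (b a : DAtom) (P : Proc DAtom) (i : Key) (K : Set SKey) :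
      FStep (.out b a P) ⟨i, K, b.2, .out b.1 a.1⟩ (.pastOut b a i K (RProc.ofProc P))
  | in1 (b : DAtom) (x : Var) (P : Proc DAtom) (i : Key) (K : Set SKey) :
      FStep (.inp b x P) ⟨i, K, b.2, .inp b.1 x⟩ (.pastInp b x i K (RProc.ofProc P))
  | out2 (b a : DAtom) (k : Key) (L : Set SKey) (X X' : RProc) (μ : FLabel) :
      FStep X μ X' → μ.key ∉ (RProc.pastOut b a k L X).keys →
      FStep (.pastOut b a k L X) μ (.pastOut b a k L X')
  | in2 (b : DAtom) (x : Var) (k : Key) (L : Set SKey) (X X' : RProc) (μ : FLabel) :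
      FStep X μ X' → μ.key ∉ (RProc.pastInp b x k L X).keys →
      FStep (.pastInp b x k L X) μ (.pastInp b x k L X')
  | parL (X X' Y : RProc) (μ : FLabel) :
      FStep X μ X' → μ.key ∉ Y.keys → FStep (.par X Y) μ (.par X' Y)
  | parR (X Y Y' : RProc) (μ : FLabel) :
      FStep Y μ Y' → μ.key ∉ X.keys → FStep (.par X Y) μ (.par X Y')
  | res (a : Name) (δ : Mem) (X X' : RProc) (μ : FLabel) :
      FStep X μ X' → .name a ∉ μ.act.atoms → FStep (.res a δ X) μ (.res a δ X')
  | comL (X X' Y Y' : RProc) (i : Key) (K K' : Set SKey) (j j' : SKey) (b a : Atom) (x : Var) :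
      FStep X ⟨i, K, j, .out b a⟩ X' → FStep Y ⟨i, K', j', .inp b x⟩ Y' →
      StarEq K j' → StarEq K' j →
      FStep (.par X Y) ⟨i, {none}, none, .tau⟩ (.par X' (Y'.subst x a i))
  | comR (X X' Y Y' : RProc) (i : Key) (K K' : Set SKey) (j j' : SKey) (b a : Atom) (x : Var) :
      FStep X ⟨i, K, j, .out b a⟩ X' → FStep Y ⟨i, K', j', .inp b x⟩ Y' →
      StarEq K j' → StarEq K' j →
      FStep (.par Y X) ⟨i, {none}, none, .tau⟩ (.par (Y'.subst x a i) X')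
  | causeRef (a : Name) (δ : Mem) (X X' : RProc) (i : Key) (K K' : Set SKey) (j : SKey)
      (π : FAct) :
      FStep X ⟨i, K, j, π⟩ X' → .name a ∈ π.sub → ¬ δ.Empty → δ.Cause K K' →
      FStep (.res a δ X) ⟨i, K', j, π⟩ (.res a δ (X'.updateCause i K K'))
  | open (a : Name) (δ : Mem) (X X' : RProc) (i : Key) (K K' : Set SKey) (j : SKey)
      (b : Atom) (π : FAct) :
      FStep X ⟨i, K, j, π⟩ X' → (π = .out b (.name a) ∨ ∃ δ', π = .bout b a δ') →
      (δ.Empty → b ≠ .name a) → δ.Update K K' →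
      FStep (.res a δ X) ⟨i, K', j, .bout b a δ⟩ (.res a (δ.add i) (X'.updateCause i K K'))
  | closeL (X X' Y Y' : RProc) (i : Key) (K K' : Set SKey) (j j' : SKey) (b : Atom) (a : Name)
      (δ : Mem) (x : Var) :
      FStep X ⟨i, K, j, .bout b a δ⟩ X' → FStep Y ⟨i, K', j', .inp b x⟩ Y' →
      StarEq K j' → StarEq K' j →
      FStep (.par X Y) ⟨i, {none}, none, .tau⟩
        (.res a δ (.par (X'.sharp i) (Y'.subst x (.name a) i)))
  | closeR (X X' Y Y' : RProc) (i : Key) (K K' : Set SKey) (j j' : SKey) (b : Atom) (a : Name)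
      (δ : Mem) (x : Var) :
      FStep X ⟨i, K, j, .bout b a δ⟩ X' → FStep Y ⟨i, K', j', .inp b x⟩ Y' →
      StarEq K j' → StarEq K' j →
      FStep (.par Y X) ⟨i, {none}, none, .tau⟩
        (.res a δ (.par (Y'.subst x (.name a) i) (X'.sharp i)))

/-! ## Structural causes in the framework -/

/-- A vertex of a history graph: an occurrence of an executed prefix, given by its address in the
syntax tree, with its key. Two occurrences of the same key are different vertices. -/
abbrev Vertex := List Bool × Key

/-- All executed prefixes of a process. An address goes down through an executed prefix with
`false`, and to the left and right of a parallel composition with `false` and `true`. Hence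
a prefix occurs in the scope of another one iff the address of the latter is
a proper initial segment of the address of the former. -/
def RProc.occs : RProc → List Vertex
  | nil => []
  | out _ _ _ => []
  | inp _ _ _ => []
  | pastOut _ _ i _ X => ([], i) :: X.occs.map fun v => (false :: v.1, v.2)
  | pastInp _ _ i _ X => ([], i) :: X.occs.map fun v => (false :: v.1, v.2)
  | par X Y => (X.occs.map fun v => (false :: v.1, v.2)) ++ Y.occs.map fun v => (true :: v.1, v.2)
  | res _ _ X => X.occs

/-- Finite directed graphs on occurrences of keys. -/
structure HistGraph : Type where
  verts : Multiset Vertex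
  edge : Vertex → Vertex → Prop

/-- The graph `G` of the dependences between the keys in the history of `X`: edges lead from a prefix
to the prefixes in its scope, and in both directions between different vertices with the
same key. -/
def RProc.histGraph (X : RProc) : HistGraph where
  verts := X.occs
  edge v w := v ∈ X.occs ∧ w ∈ X.occs ∧ v ≠ w ∧ (v.1 <+: w.1 ∨ v.2 = w.2)

namespace HistGraph

/-- The vertices from which a path leads to a vertex with key `i`. -/
def Reaches (G : HistGraph) (i : Key) (v : Vertex) : Prop :=
  ∃ w ∈ G.verts, w.2 = i ∧ Relation.ReflTransGen G.edge v w

open Classical in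
/-- The graph `G(i)` made of all paths of `G` whose target has key `i`. -/
noncomputable def past (G : HistGraph) (i : Key) : HistGraph where
  verts := G.verts.filter (G.Reaches i)
  edge v w := G.edge v w ∧ G.Reaches i v ∧ G.Reaches i w

/-- The two vertices are connected by a bidirectional edge. -/
def Bidir (G : HistGraph) (v w : Vertex) : Prop := G.edge v w ∧ G.edge w v

/-- Vertices after contraction of the bidirectional edges: an old key, or a vertex `τ_l`, which is
named here by the set of the vertices that were merged into it. -/
inductive CVertex : Type
  | key (k : Key)
  | tau (l : Set Vertex)

open Classical in
/-- The vertex that a vertex becomes when all bidirectional edges are contracted. -/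
noncomputable def contract (G : HistGraph) (v : Vertex) : CVertex :=
  if ∃ w, G.Bidir v w then .tau {w | Relation.ReflTransGen G.Bidir v w} else .key v.2

/-- The vertex set `V'` of the contracted graph. -/
def contractedVerts (G : HistGraph) : Set CVertex := {c | ∃ v ∈ G.verts, G.contract v = c}

end HistGraph

/-- The multiset `K_F = V(i) \ {i}` of the structural causes of the action with key `i` in the
history of `X`. -/
noncomputable def RProc.structCauses (X : RProc) (i : Key) : Multiset Key :=
  ((X.histGraph.past i).verts.map Prod.snd).filter (· ≠ i)

/-- The algorithm `Rem` (removing keys from a set), applied to the multiset `KF` of structural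
causes of the action with key `i` in the history of `X`: it contracts the bidirectional edges of
`G(i)` and drops the vertices `τ_l`. -/
def RProc.Rem (X : RProc) (i : Key) (KF : Multiset Key) : Set Key :=
  {k | k ∈ KF ∧ HistGraph.CVertex.key k ∈ (X.histGraph.past i).contractedVerts}

/-- Forward transitions, annotated with the multiset of structural causes of the executed action. -/
def FStepK (X : RProc) (KF : Multiset Key) (μ : FLabel) (X' : RProc) : Prop :=
  FStep X μ X' ∧ KF = X'.structCauses μ.key

/-! ## The causal semantics of Boreale and Sangiorgi, in late style -/

/-- Causal processes `A ::= P | K :: A | A | A | ν a A`, where `P` is a π-calculus process. -/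
inductive CProc : Type
  | nil
  | out (b a : Atom) (P : Proc Atom)
  | inp (b : Atom) (x : Var) (P : Proc Atom)
  | par (A B : CProc)
  | res (a : Name) (A : CProc)
  | cause (K : Set Key) (A : CProc)

namespace CProc

/-- A π-calculus process as a causal process. -/
def ofProc : Proc Atom → CProc
  | .nil => nil
  | .out b a P => out b a P
  | .inp b x P => inp b x P
  | .par P Q => par (ofProc P) (ofProc Q)
  | .res a P => res a (ofProc P)

/-- The erasing function `λ`. -/
def erase : CProc → Proc Atom
  | nil => .nil
  | out b a P => .out b a P
  | inp b x P => .inp b x P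
  | par A B => .par A.erase B.erase
  | res a A => .res a A.erase
  | cause _ A => A.erase

/-- The keys that occur in the cause sets of a causal process. -/
def keys : CProc → Set Key
  | nil => ∅
  | out _ _ _ => ∅
  | inp _ _ _ => ∅
  | par A B => A.keys ∪ B.keys
  | res _ A => A.keys
  | cause K A => K ∪ A.keys

/-- Free names and variables. -/
def free (A : CProc) : Set Atom := A.erase.free

/-- The substitution `A{v/x}`. -/
noncomputable def subst (x : Var) (v : Atom) : CProc → CProc
  | nil => nil
  | out b a P => out (Atom.replace x v b) (Atom.replace x v a) (P.subst x v)
  | inp b y P => inp (Atom.replace x v b) y (if y = x then P else P.subst x v)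
  | par A B => par (A.subst x v) (B.subst x v)
  | res a A => res a (A.subst x v)
  | cause K A => cause K (A.subst x v)

/-- The replacement `A[k ⇝ L]` of the cause `k` by the causes in `L`, in all cause sets. -/
def replaceCause (k : Key) (L : Set Key) : CProc → CProc
  | nil => nil
  | out b a P => out b a P
  | inp b x P => inp b x P
  | par A B => par (A.replaceCause k L) (B.replaceCause k L)
  | res a A => res a (A.replaceCause k L)
  | cause K A => cause {m | (m ∈ K ∧ m ≠ k) ∨ (k ∈ K ∧ m ∈ L)} (A.replaceCause k L)

end CProc

/-- Visible actions: free output, bound output, input. -/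
inductive BAct : Type
  | out (b a : Atom)
  | bout (b : Atom) (a : Name)
  | inp (b : Atom) (x : Var)

/-- Labels `ζ`: a visible action with its key, or a silent action. -/
inductive BLabel : Type
  | vis (k : Key) (π : BAct)
  | tau

namespace BLabel

def keys : BLabel → Set Key
  | vis k _ => {k}
  | tau => ∅

/-- The names and variables that occur in a label. -/
def atoms : BLabel → Set Atom
  | vis _ (.out b a) => {b, a}
  | vis _ (.bout b a) => {b, .name a}
  | vis _ (.inp b x) => {b, .var x}
  | tau => ∅

/-- Bound names and variables of a label. -/
def bound : BLabel → Set Atom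
  | vis _ (.out _ _) => ∅
  | vis _ (.bout _ a) => {.name a}
  | vis _ (.inp _ x) => {.var x}
  | tau => ∅

end BLabel

/-- The late causal transitions `A --K,ζ--> A'`. For a visible label `ζ = k : π`, the set `K` is the
cause set of the action. A silent label shows neither a key nor causes; the set `K` that is kept
next to it here is the union of the cause sets of the two actions that synchronise, and forgetting
it gives the silent transitions of the original semantics, because no rule depends on it. -/
inductive BStep : CProc → Set Key → BLabel → CProc → Prop
  | out (b a : Atom) (P : Proc Atom) (k : Key) :
      BStep (.out b a P) ∅ (.vis k (.out b a)) (.cause {k} (CProc.ofProc P))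
  | inp (b : Atom) (x : Var) (P : Proc Atom) (k : Key) :
      BStep (.inp b x P) ∅ (.vis k (.inp b x)) (.cause {k} (CProc.ofProc P))
  | cau (L : Set Key) (A A' : CProc) (K : Set Key) (ζ : BLabel) :
      BStep A K ζ A' → Disjoint ζ.keys L → BStep (.cause L A) (L ∪ K) ζ (.cause L A')
  | parL (A A' B : CProc) (K : Set Key) (ζ : BLabel) :
      BStep A K ζ A' → Disjoint ζ.keys B.keys → Disjoint ζ.bound B.free →
      BStep (.par A B) K ζ (.par A' B)
  | parR (A B B' : CProc) (K : Set Key) (ζ : BLabel) :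
      BStep B K ζ B' → Disjoint ζ.keys A.keys → Disjoint ζ.bound A.free →
      BStep (.par A B) K ζ (.par A B')
  | res (a : Name) (A A' : CProc) (K : Set Key) (ζ : BLabel) :
      BStep A K ζ A' → .name a ∉ ζ.atoms → BStep (.res a A) K ζ (.res a A')
  | open (a : Name) (b : Atom) (A A' : CProc) (K : Set Key) (k : Key) :
      BStep A K (.vis k (.out b (.name a))) A' → b ≠ .name a →
      BStep (.res a A) K (.vis k (.bout b a)) A'
  | comL (A A' B B' : CProc) (K L : Set Key) (k : Key) (b a : Atom) (x : Var) :
      BStep A K (.vis k (.out b a)) A' → BStep B L (.vis k (.inp b x)) B' →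
      BStep (.par A B) (K ∪ L) .tau
        (.par (A'.replaceCause k L) ((B'.subst x a).replaceCause k K))
  | comR (A A' B B' : CProc) (K L : Set Key) (k : Key) (b a : Atom) (x : Var) :
      BStep A K (.vis k (.out b a)) A' → BStep B L (.vis k (.inp b x)) B' →
      BStep (.par B A) (K ∪ L) .tau
        (.par ((B'.subst x a).replaceCause k K) (A'.replaceCause k L))
  | closeL (A A' B B' : CProc) (K L : Set Key) (k : Key) (b : Atom) (a : Name) (x : Var) :
      BStep A K (.vis k (.bout b a)) A' → BStep B L (.vis k (.inp b x)) B' → .name a ∉ B.free →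
      BStep (.par A B) (K ∪ L) .tau
        (.res a (.par (A'.replaceCause k L) ((B'.subst x (.name a)).replaceCause k K)))
  | closeR (A A' B B' : CProc) (K L : Set Key) (k : Key) (b : Atom) (a : Name) (x : Var) :
      BStep A K (.vis k (.bout b a)) A' → BStep B L (.vis k (.inp b x)) B' → .name a ∉ B.free →
      BStep (.par B A) (K ∪ L) .tau
        (.res a (.par ((B'.subst x (.name a)).replaceCause k K) (A'.replaceCause k L)))

open Classical in
/-- The function `γ` from labels of the framework to labels of the causal semantics. -/
noncomputable def gamma (μ : FLabel) : BLabel :=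
  match μ.act with
  | .out b a => .vis μ.key (.out b a)
  | .inp b x => .vis μ.key (.inp b x)
  | .bout b a δ => .vis μ.key (if δ.Empty then .bout b a else .out b (.name a))
  | .tau => .tau

end PiCausal

open PiCausal

/-!
Give every executed prefix of a reversible process a cause set. The result reads as a causal
process: an executed prefix becomes `K::`, and a restriction with non-empty memory disappears.
Under this reading the transitions of the two calculi match one by one, and each adds to the
history one vertex for a visible action, or two vertices with the same key for a synchronisation.

The causes at and above a vertex are exactly the keys in its past that no other vertex carries.
A visible action preserves this because its causes are those of all the prefixes above it. A
synchronisation preserves it because exchanging the two cause sets has the effect of the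
bidirectional edge, which joins the two pasts, while the key of the synchronisation, carried by
two vertices, is lost both by substitution and by contraction. At the vertices with key `i` this
invariant says that `K_B` is `Rem(K_F)`.

A silent causal step carries no key, so its reversible counterpart is free to choose one; it must
avoid the keys which the later visible actions will use.
-/

namespace PiCausal

/-! ### Reading a causal process off a reversible process -/

/-- Assigns cause sets to the addresses of executed prefixes. -/
abbrev Causes := List Bool → Set Key

namespace Causes

/-- The assignment for the subtree reached by the step `t`. -/
def below (κ : Causes) (t : Bool) : Causes := fun l => κ (t :: l)

/-- Replaces the assignment for the subtree reached by the step `t`. -/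
def graft (κ : Causes) (t : Bool) (κ₁ : Causes) : Causes
  | [] => κ []
  | s :: l => if s = t then κ₁ l else κ (s :: l)

@[simp] theorem graft_nil (κ : Causes) (t : Bool) (κ₁ : Causes) : κ.graft t κ₁ [] = κ [] := rfl

@[simp] theorem graft_cons_self (κ : Causes) (t : Bool) (κ₁ : Causes) (l : List Bool) :
    κ.graft t κ₁ (t :: l) = κ₁ l := if_pos rfl

theorem graft_of_not_isPrefix (κ : Causes) {t : Bool} (κ₁ : Causes) {l : List Bool}
    (h : ¬ [t] <+: l) : κ.graft t κ₁ l = κ l := by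
  cases l <;> simp_all [graft, eq_comm]

@[simp] theorem below_graft_self (κ : Causes) (t : Bool) (κ₁ : Causes) :
    (κ.graft t κ₁).below t = κ₁ := funext fun _ => if_pos rfl

theorem below_graft_of_ne (κ : Causes) {s t : Bool} (κ₁ : Causes) (h : s ≠ t) :
    (κ.graft t κ₁).below s = κ.below s := funext fun _ => if_neg h

@[simp] theorem below_false_graft_true (κ κ₁ : Causes) :
    (κ.graft true κ₁).below false = κ.below false := κ.below_graft_of_ne κ₁ (by decide)

@[simp] theorem below_true_graft_false (κ κ₁ : Causes) :
    (κ.graft false κ₁).below true = κ.below true := κ.below_graft_of_ne κ₁ (by decide)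

end Causes

/-- The cause set that results from `S` when the cause `k` is replaced by the causes in `L`. -/
def replaceKey (k : Key) (L S : Set Key) : Set Key := {m | (m ∈ S ∧ m ≠ k) ∨ (k ∈ S ∧ m ∈ L)}

theorem replaceKey_of_notMem {k : Key} {S : Set Key} (L : Set Key) (h : k ∉ S) :
    replaceKey k L S = S := by
  ext m
  simp only [replaceKey, Set.mem_ofPred_eq, h, false_and, or_false, and_iff_left_iff_imp]
  rintro hm rfl
  exact h hm

theorem replaceKey_singleton (k : Key) (L : Set Key) : replaceKey k L {k} = L := by
  ext m
  simp [replaceKey]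

theorem Mem.init_empty : Mem.init.Empty := ⟨rfl, rfl⟩

namespace RProc

open Classical in
/-- The causal process whose executed prefixes are those of `X`, with the cause sets `κ`. A
restriction with non-empty memory binds nothing any more, so it leaves no trace. -/
noncomputable def toC : RProc → Causes → CProc
  | .nil, _ => .nil
  | .out b a P, _ => .out b.1 a.1 (P.map Prod.fst)
  | .inp b x P, _ => .inp b.1 x (P.map Prod.fst)
  | .pastOut _ _ _ _ X, κ => .cause (κ []) (X.toC (κ.below false))
  | .pastInp _ _ _ _ X, κ => .cause (κ []) (X.toC (κ.below false))
  | .par X Y, κ => .par (X.toC (κ.below false)) (Y.toC (κ.below true))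
  | .res a δ X, κ => if δ.Empty then .res a (X.toC κ) else X.toC κ

theorem toC_res_of_empty {a : Name} {δ : Mem} (h : δ.Empty) (X : RProc) (κ : Causes) :
    (RProc.res a δ X).toC κ = .res a (X.toC κ) := if_pos h

theorem toC_res_of_not_empty {a : Name} {δ : Mem} (h : ¬ δ.Empty) (X : RProc) (κ : Causes) :
    (RProc.res a δ X).toC κ = X.toC κ := if_neg h

theorem toC_ofProc (P : Proc DAtom) (κ : Causes) :
    (ofProc P).toC κ = CProc.ofProc (P.map Prod.fst) := by
  induction P generalizing κ <;> simp_all [ofProc, toC, CProc.ofProc, Proc.map, Mem.init_empty]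

theorem toC_initial (P : Proc Atom) (κ : Causes) : (initial P).toC κ = CProc.ofProc P := by
  rw [initial, toC_ofProc]
  congr 1
  induction P <;> simp_all [Proc.map]

end RProc

namespace CProc

theorem erase_ofProc (P : Proc Atom) : (CProc.ofProc P).erase = P := by
  induction P <;> simp_all [CProc.ofProc, CProc.erase]

theorem erase_subst (A : CProc) (x : Var) (v : Atom) :
    (A.subst x v).erase = A.erase.subst x v := by
  induction A with
  | _ => simp_all [CProc.subst, CProc.erase, Proc.subst, Proc.substBy]

theorem erase_replaceCause (A : CProc) (k : Key) (L : Set Key) :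
    (A.replaceCause k L).erase = A.erase := by
  induction A <;> simp_all [CProc.replaceCause, CProc.erase]

end CProc

namespace RProc

theorem erase_toC (X : RProc) (κ : Causes) : (X.toC κ).erase = X.erase := by
  induction X generalizing κ with
  | res a δ X ih => by_cases h : δ.Empty <;> simp [toC, erase, CProc.erase, h, ih]
  | _ => simp_all [toC, erase, CProc.erase]

theorem erase_eq_of_toC_eq {X Y : RProc} (h : ∀ κ, X.toC κ = Y.toC κ) : X.erase = Y.erase := by
  rw [← erase_toC X fun _ => ∅, h, erase_toC]

theorem free_toC (X : RProc) (κ : Causes) : (X.toC κ).free = X.erase.free := by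
  rw [CProc.free, erase_toC]

theorem erase_ofProc (P : Proc DAtom) : (ofProc P).erase = P.map Prod.fst := by
  rw [← erase_toC _ fun _ => ∅, toC_ofProc, CProc.erase_ofProc]

end RProc

/-! ### Vertices -/

/-- The vertex that a vertex becomes when its process is put below a node. -/
def Vertex.push (t : Bool) (v : Vertex) : Vertex := (t :: v.1, v.2)

namespace RProc

/-- The set of the executed prefixes of a process. -/
def vertices (X : RProc) : Set Vertex := {v | v ∈ X.occs}

theorem vertices_out (b a : DAtom) (P : Proc DAtom) : (out b a P).vertices = ∅ := by
  simp [vertices, occs]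

theorem vertices_inp (b : DAtom) (x : Var) (P : Proc DAtom) : (inp b x P).vertices = ∅ := by
  simp [vertices, occs]

theorem vertices_pastOut (b a : DAtom) (k : Key) (K : Set SKey) (X : RProc) :
    (pastOut b a k K X).vertices = {([], k)} ∪ Vertex.push false '' X.vertices := by
  ext v
  simp [vertices, occs, Vertex.push]

theorem vertices_pastInp (b : DAtom) (x : Var) (k : Key) (K : Set SKey) (X : RProc) :
    (pastInp b x k K X).vertices = {([], k)} ∪ Vertex.push false '' X.vertices := by
  ext v
  simp [vertices, occs, Vertex.push]

theorem vertices_par (X Y : RProc) :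
    (par X Y).vertices = Vertex.push false '' X.vertices ∪ Vertex.push true '' Y.vertices := by
  ext v
  simp [vertices, occs, Vertex.push]

theorem vertices_ofProc (P : Proc DAtom) : (ofProc P).vertices = ∅ := by
  have h : (ofProc P).occs = [] := by induction P <;> simp_all [ofProc, occs]
  simp [vertices, h]

theorem mem_keys {X : RProc} {k : Key} : k ∈ X.keys ↔ ∃ v ∈ X.vertices, v.2 = k := by
  induction X with
  | par X Y ihX ihY => simp_all [keys, vertices, occs, or_and_right, exists_or]
  | _ => simp_all [keys, vertices, occs, eq_comm]

theorem mem_keys_toC {X : RProc} {κ : Causes} {m : Key} :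
    m ∈ (X.toC κ).keys ↔ ∃ v ∈ X.vertices, m ∈ κ v.1 := by
  induction X generalizing κ with
  | par X Y ihX ihY =>
    simp_all [toC, CProc.keys, vertices, occs, Causes.below, or_and_right, exists_or]
  | res a δ X ih => by_cases h : δ.Empty <;> simp_all [toC, vertices, occs, CProc.keys]
  | _ => simp_all [toC, CProc.keys, vertices, occs, Causes.below]

end RProc

/-! ### Operations on reversible processes -/

theorem replaceD_fst (x : Var) (v : Atom) (i : Key) (c : DAtom) :
    (replaceD x v i c).1 = Atom.replace x v c.1 := by
  unfold replaceD Atom.replace; split_ifs <;> rfl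

theorem Proc.map_substBy (P : Proc DAtom) (x : Var) (v : Atom) (i : Key) :
    (P.substBy x (replaceD x v i)).map Prod.fst = (P.map Prod.fst).subst x v := by
  unfold Proc.subst
  induction P with
  | inp b y P ih => by_cases hy : y = x <;> simp [Proc.substBy, Proc.map, replaceD_fst, hy, ih]
  | _ => simp_all [Proc.substBy, Proc.map, replaceD_fst]

theorem Proc.binders_subst (P : Proc Atom) (x : Var) (v : Atom) :
    (P.subst x v).binders = P.binders := by
  unfold Proc.subst
  induction P with
  | inp b y P ih => by_cases hy : y = x <;> simp [Proc.substBy, Proc.binders, hy, ih]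
  | _ => simp_all [Proc.substBy, Proc.binders]

namespace RProc

theorem toC_subst (X : RProc) (κ : Causes) (x : Var) (v : Atom) (i : Key) :
    (X.subst x v i).toC κ = (X.toC κ).subst x v := by
  induction X generalizing κ with
  | inp b y P =>
    by_cases hy : y = x <;> simp [subst, toC, CProc.subst, replaceD_fst, hy, Proc.map_substBy]
  | res a δ X ih => by_cases h : δ.Empty <;> simp [subst, toC, CProc.subst, h, ih]
  | _ => simp_all [subst, toC, CProc.subst, replaceD_fst, Proc.map_substBy]

theorem toC_updateCause (X : RProc) (i : Key) (K K' : Set SKey) (κ : Causes) :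
    (X.updateCause i K K').toC κ = X.toC κ := by
  induction X generalizing κ <;> simp_all [updateCause, toC]

theorem toC_replaceCause (X : RProc) (κ : Causes) (k : Key) (L : Set Key) :
    (X.toC κ).replaceCause k L = X.toC fun l => replaceKey k L (κ l) := by
  induction X generalizing κ with
  | res a δ X ih => by_cases h : δ.Empty <;> simp [toC, CProc.replaceCause, h, ih]
  | pastOut _ _ _ _ _ ih | pastInp _ _ _ _ _ ih => exact congrArg (CProc.cause _) (ih _)
  | par X Y ihX ihY => exact congrArg₂ CProc.par (ihX _) (ihY _)
  | nil | out | inp => rfl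

theorem vertices_subst (X : RProc) (x : Var) (v : Atom) (i : Key) :
    (X.subst x v i).vertices = X.vertices := by
  have h : (X.subst x v i).occs = X.occs := by induction X <;> simp_all [subst, occs]
  simp [vertices, h]

theorem vertices_updateCause (X : RProc) (i : Key) (K K' : Set SKey) :
    (X.updateCause i K K').vertices = X.vertices := by
  have h : (X.updateCause i K K').occs = X.occs := by induction X <;> simp_all [updateCause, occs]
  simp [vertices, h]

theorem vertices_sharp (X : RProc) (i : Key) : (X.sharp i).vertices = X.vertices := by
  have h : (X.sharp i).occs = X.occs := by induction X <;> simp_all [sharp, occs]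
  simp [vertices, h]

theorem binders_erase_subst (X : RProc) (x : Var) (v : Atom) (i : Key) :
    (X.subst x v i).erase.binders = X.erase.binders := by
  rw [← erase_toC _ fun _ => ∅, toC_subst, CProc.erase_subst, Proc.binders_subst, erase_toC]

theorem erase_updateCause (X : RProc) (i : Key) (K K' : Set SKey) :
    (X.updateCause i K K').erase = X.erase := erase_eq_of_toC_eq (X.toC_updateCause i K K')

end RProc

/-! ### Memories -/

namespace Mem

/-- A non-empty index comes with a non-empty set. -/
def Ok (δ : Mem) : Prop := δ.set = ∅ → δ.idx = none

theorem not_empty_add (δ : Mem) (i : Key) : ¬ (δ.add i).Empty := fun h =>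
  (Set.insert_nonempty _ _).ne_empty h.1

theorem ok_add (δ : Mem) (i : Key) : (δ.add i).Ok := fun h =>
  absurd h (Set.insert_nonempty _ _).ne_empty

theorem Ok.sharp {δ : Mem} (h : δ.Ok) (i : Key) : (δ.sharp i).Ok := by
  unfold Mem.sharp
  split_ifs
  · exact fun _ => rfl
  · exact h

theorem Ok.empty_sharp_iff {δ : Mem} (h : δ.Ok) (i : Key) : (δ.sharp i).Empty ↔ δ.Empty := by
  unfold Mem.sharp
  split_ifs with hi
  · exact ⟨fun he => ⟨he.1, h he.1⟩, fun he => by simp [he.2] at hi⟩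
  · rfl

end Mem

namespace RProc

/-- All memories of the process are `Mem.Ok`. -/
def MemOk : RProc → Prop
  | .nil => True
  | .out _ _ _ => True
  | .inp _ _ _ => True
  | .pastOut _ _ _ _ X => X.MemOk
  | .pastInp _ _ _ _ X => X.MemOk
  | .par X Y => X.MemOk ∧ Y.MemOk
  | .res _ δ X => δ.Ok ∧ X.MemOk

theorem memOk_ofProc (P : Proc DAtom) : (ofProc P).MemOk := by
  induction P with
  | res _ _ ih => exact ⟨fun _ => rfl, ih⟩
  | _ => simp_all [ofProc, MemOk]

theorem MemOk.toC_sharp {X : RProc} (h : X.MemOk) (i : Key) (κ : Causes) :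
    (X.sharp i).toC κ = X.toC κ := by
  induction X generalizing κ with
  | res a δ X ih =>
    by_cases hδ : δ.Empty <;> simp [RProc.sharp, toC, h.1.empty_sharp_iff i, hδ, ih h.2]
  | _ => simp_all [RProc.sharp, toC, MemOk]

theorem MemOk.erase_sharp {X : RProc} (h : X.MemOk) (i : Key) : (X.sharp i).erase = X.erase :=
  erase_eq_of_toC_eq (h.toC_sharp i)

theorem MemOk.subst {X : RProc} (h : X.MemOk) (x : Var) (v : Atom) (i : Key) :
    (X.subst x v i).MemOk := by
  induction X <;> simp_all [RProc.subst, MemOk]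

theorem MemOk.updateCause {X : RProc} (h : X.MemOk) (i : Key) (K K' : Set SKey) :
    (X.updateCause i K K').MemOk := by
  induction X <;> simp_all [RProc.updateCause, MemOk]

theorem MemOk.sharp {X : RProc} (h : X.MemOk) (i : Key) : (X.sharp i).MemOk := by
  induction X <;> simp_all [RProc.sharp, MemOk, Mem.Ok.sharp]

end RProc

-- `open` is a keyword, so the case of the rule for opening can only be matched by `_`.
theorem FStep.ok_of_bout {X X' : RProc} {i : Key} {K : Set SKey} {j : SKey} {b : Atom} {a : Name}
    {δ : Mem} (h : FStep X ⟨i, K, j, .bout b a δ⟩ X') (hX : X.MemOk) : δ.Ok := by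
  generalize hμ : FLabel.mk i K j (.bout b a δ) = μ at h
  induction h generalizing i K j with
  | out2 _ _ _ _ _ _ _ _ _ ih | in2 _ _ _ _ _ _ _ _ _ ih => exact ih hX hμ
  | parL _ _ _ _ _ _ ih => exact ih hX.1 hμ
  | parR _ _ _ _ _ _ ih => exact ih hX.2 hμ
  | res _ _ _ _ _ _ _ ih => exact ih hX.2 hμ
  | causeRef _ _ _ _ _ _ _ _ _ _ _ _ _ ih => cases hμ; exact ih hX.2 rfl
  | out1 | in1 | comL | comR | closeL | closeR => cases hμ
  | _ => cases hμ; exact hX.1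

theorem FStep.memOk {X X' : RProc} {μ : FLabel} (h : FStep X μ X') (hX : X.MemOk) : X'.MemOk := by
  induction h with
  | out1 | in1 => exact RProc.memOk_ofProc _
  | out2 _ _ _ _ _ _ _ _ _ ih | in2 _ _ _ _ _ _ _ _ _ ih => exact ih hX
  | parL _ _ _ _ _ _ ih => exact ⟨ih hX.1, hX.2⟩
  | parR _ _ _ _ _ _ ih => exact ⟨hX.1, ih hX.2⟩
  | res _ _ _ _ _ _ _ ih => exact ⟨hX.1, ih hX.2⟩
  | causeRef _ _ _ _ _ _ _ _ _ _ _ _ _ ih => exact ⟨hX.1, (ih hX.2).updateCause ..⟩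
  | comL _ _ _ _ _ _ _ _ _ _ _ _ _ _ _ _ ihX ihY => exact ⟨ihX hX.1, (ihY hX.2).subst ..⟩
  | comR _ _ _ _ _ _ _ _ _ _ _ _ _ _ _ _ ihX ihY => exact ⟨(ihY hX.1).subst .., ihX hX.2⟩
  | closeL _ _ _ _ _ _ _ _ _ _ _ _ _ hout _ _ _ ihX ihY =>
    exact ⟨hout.ok_of_bout hX.1, (ihX hX.1).sharp _, (ihY hX.2).subst ..⟩
  | closeR _ _ _ _ _ _ _ _ _ _ _ _ _ hout _ _ _ ihX ihY =>
    exact ⟨hout.ok_of_bout hX.2, (ihY hX.1).subst .., (ihX hX.2).sharp _⟩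
  | _ _ _ _ _ _ _ _ _ _ _ _ _ _ _ ih => exact ⟨Mem.ok_add _ _, (ih hX.2).updateCause ..⟩

/-! ### Names and variables in causal transitions -/

theorem Atom.replace_eq_or (x : Var) (v c : Atom) :
    Atom.replace x v c = v ∨ Atom.replace x v c = c ∧ c ≠ .var x := by
  unfold Atom.replace
  split_ifs with h
  · exact Or.inl rfl
  · exact Or.inr ⟨rfl, h⟩

theorem Proc.free_subst_subset (P : Proc Atom) (x : Var) (v : Atom) :
    (P.subst x v).free ⊆ (P.free \ {.var x}) ∪ {v} := by
  unfold Proc.subst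
  have h := Atom.replace_eq_or x v
  induction P with
  | inp b y P ih =>
    by_cases hy : y = x <;> simp only [Proc.substBy, Proc.free, hy, if_true, if_false] <;> grind
  | _ =>
    simp only [Proc.substBy, Proc.free]
    grind

theorem BStep.label_free {A A' : CProc} {K : Set Key} {ζ : BLabel} (h : BStep A K ζ A') :
    ζ.atoms ⊆ A.free ∪ ζ.bound := by
  induction h with
  | out | inp =>
    rintro c (rfl | rfl) <;> simp [CProc.free, CProc.erase, Proc.free, BLabel.bound]
  | cau _ _ _ _ _ _ _ ih => exact ih
  | comL | comR | closeL | closeR => simp [BLabel.atoms]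
  | _ =>
    simp only [CProc.free, CProc.erase, Proc.free, BLabel.atoms, BLabel.bound] at *
    grind

theorem CProc.free_replaceCause (A : CProc) (k : Key) (L : Set Key) :
    (A.replaceCause k L).free = A.free := by
  rw [CProc.free, CProc.erase_replaceCause, CProc.free]

theorem CProc.free_subst_subset (A : CProc) (x : Var) (v : Atom) :
    (A.subst x v).free ⊆ (A.free \ {.var x}) ∪ {v} := by
  rw [CProc.free, CProc.erase_subst]
  exact A.erase.free_subst_subset x v

theorem BStep.free_subset {A A' : CProc} {K : Set Key} {ζ : BLabel} (h : BStep A K ζ A') :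
    A'.free ⊆ A.free ∪ ζ.bound := by
  have free_par (A B : CProc) : (CProc.par A B).free = A.free ∪ B.free := rfl
  have free_res (a : Name) (A : CProc) : (CProc.res a A).free = A.free \ {.name a} := rfl
  induction h with
  | out b a P | inp b a P =>
    simp only [CProc.free, CProc.erase, CProc.erase_ofProc, Proc.free, BLabel.bound]
    grind
  | cau _ _ _ _ _ _ _ ih => exact ih
  | parL | parR | res => grind
  | comL A _ B B' _ _ _ _ a x hA _ ihA ihB | comR A _ B B' _ _ _ _ a x hA _ ihA ihB =>
    have ha : a ∈ A.free := by simpa [BLabel.bound] using hA.label_free (Or.inr rfl)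
    have hB' : (B'.subst x a).free ⊆ B.free ∪ {a} :=
      (B'.free_subst_subset x a).trans (Set.union_subset_union_left _ (Set.sdiff_subset_iff.2
        (Set.union_comm .. ▸ ihB)))
    simp only [free_par, CProc.free_replaceCause, BLabel.bound, Set.union_empty] at ihA ⊢
    grind
  | closeL _ _ B B' _ _ _ _ a x _ _ _ ihA ihB | closeR _ _ B B' _ _ _ _ a x _ _ _ ihA ihB =>
    have hB' : (B'.subst x (.name a)).free ⊆ B.free ∪ {.name a} :=
      (B'.free_subst_subset x _).trans (Set.union_subset_union_left _ (Set.sdiff_subset_iff.2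
        (Set.union_comm .. ▸ ihB)))
    simp only [free_par, free_res, CProc.free_replaceCause, BLabel.bound, Set.union_empty] at ihA ⊢
    grind
  | _ =>
    simp only [free_res, BLabel.bound] at *
    grind

/-- The binders of a causal process, as a multiset. -/
def CProc.binders (A : CProc) : Multiset Atom := A.erase.binders

/-- The bound names and variables of a label as a multiset, for counting them as binders. -/
def BLabel.boundBinders : BLabel → Multiset Atom
  | .vis _ (.out _ _) => 0
  | .vis _ (.bout _ a) => {.name a}
  | .vis _ (.inp _ x) => {.var x}
  | .tau => 0

theorem BLabel.mem_boundBinders {ζ : BLabel} {c : Atom} : c ∈ ζ.boundBinders ↔ c ∈ ζ.bound := by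
  rcases ζ with ⟨k, _ | _ | _⟩ | _ <;> simp [BLabel.boundBinders, BLabel.bound]

theorem BStep.binders_le {A A' : CProc} {K : Set Key} {ζ : BLabel} (h : BStep A K ζ A') :
    ζ.boundBinders + A'.binders ≤ A.binders := by
  have binders_par (A B : CProc) : (CProc.par A B).binders = A.binders + B.binders :=
    (Multiset.coe_add _ _).symm
  have binders_res (a : Name) (A : CProc) : (CProc.res a A).binders = {.name a} + A.binders := rfl
  have binders_subst (A : CProc) (x : Var) (v : Atom) : (A.subst x v).binders = A.binders := by
    simp only [CProc.binders, CProc.erase_subst, Proc.binders_subst]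
  have binders_replaceCause (A : CProc) (k : Key) (L : Set Key) :
      (A.replaceCause k L).binders = A.binders := by
    simp only [CProc.binders, CProc.erase_replaceCause]
  induction h with
  | out b a P | inp b a P =>
    simp [BLabel.boundBinders, CProc.binders, CProc.erase, CProc.erase_ofProc, Proc.binders]
  | cau _ _ _ _ _ _ _ ih => exact ih
  | parL _ _ _ _ _ _ _ _ ih =>
    rw [binders_par, binders_par, ← add_assoc]
    gcongr
  | parR _ _ _ _ _ _ _ _ ih =>
    rw [binders_par, binders_par, add_left_comm]
    gcongr
  | res _ _ _ _ _ _ _ ih =>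
    rw [binders_res, binders_res, add_left_comm]
    gcongr
  | comL _ _ _ _ _ _ _ _ _ _ _ _ ihA ihB | closeL _ _ _ _ _ _ _ _ _ _ _ _ _ ihA ihB =>
    simpa only [BLabel.boundBinders, binders_res, binders_par, binders_subst,
      binders_replaceCause, zero_add, add_assoc] using add_le_add ihA (le_of_add_le_right ihB)
  | comR _ _ _ _ _ _ _ _ _ _ _ _ ihA ihB | closeR _ _ _ _ _ _ _ _ _ _ _ _ _ ihA ihB =>
    simpa only [BLabel.boundBinders, binders_res, binders_par, binders_subst,
      binders_replaceCause, zero_add, add_left_comm] using add_le_add (le_of_add_le_right ihB) ihA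
  | _ _ _ _ _ _ _ _ _ ih =>
    rw [binders_res]
    simpa only [BLabel.boundBinders, zero_add] using add_le_add_right ih _

theorem BStep.bound_subset {A A' : CProc} {K : Set Key} {ζ : BLabel} (h : BStep A K ζ A') :
    ∀ c ∈ ζ.bound, c ∈ A.erase.binders := fun _ hc =>
  Multiset.mem_coe.1 (Multiset.mem_of_le (le_of_add_le_left h.binders_le)
    (BLabel.mem_boundBinders.2 hc))

theorem BStep.binders_subset {A A' : CProc} {K : Set Key} {ζ : BLabel} (h : BStep A K ζ A') :
    A'.erase.binders ⊆ A.erase.binders := fun _ hc =>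
  Multiset.mem_coe.1 (Multiset.mem_of_le (le_of_add_le_right h.binders_le) (Multiset.mem_coe.2 hc))

theorem BStep.boundDistinct {A A' : CProc} {K : Set Key} {ζ : BLabel} (h : BStep A K ζ A')
    (hA : A.erase.BoundDistinct) : A'.erase.BoundDistinct := by
  have hnodup := Multiset.nodup_of_le h.binders_le (Multiset.coe_nodup.2 hA.1)
  obtain ⟨-, hA', hdisj⟩ := Multiset.nodup_add.1 hnodup
  refine ⟨Multiset.coe_nodup.1 hA', fun c hc hf => ?_⟩
  rcases h.free_subset hf with hf | hb
  · exact hA.2 c (h.binders_subset hc) hf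
  · exact Multiset.disjoint_left.1 hdisj (BLabel.mem_boundBinders.2 hb) (Multiset.mem_coe.2 hc)

theorem BStep.disjoint_keys {A A' : CProc} {K : Set Key} {ζ : BLabel} (h : BStep A K ζ A') :
    Disjoint ζ.keys A.keys := by
  induction h with
  | out | inp => exact Set.disjoint_empty _
  | cau _ _ _ _ _ _ hL ih => exact hL.union_right ih
  | parL _ _ _ _ _ _ hB _ ih => exact ih.union_right hB
  | parR _ _ _ _ _ _ hA _ ih => exact hA.union_right ih
  | res _ _ _ _ _ _ _ ih => exact ih
  | comL | comR | closeL | closeR => exact Set.empty_disjoint _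
  | _ _ _ _ _ _ _ _ _ ih => exact ih

theorem BStep.key_notMem {A A' : CProc} {K : Set Key} {k : Key} {π : BAct}
    (h : BStep A K (.vis k π) A') : k ∉ A.keys :=
  Set.disjoint_singleton_left.1 h.disjoint_keys

theorem Proc.BoundDistinct.of_par {P Q : Proc Atom} (h : (Proc.par P Q).BoundDistinct) :
    P.BoundDistinct ∧ Q.BoundDistinct ∧ (∀ c ∈ P.binders, c ∉ Q.free) ∧
      ∀ c ∈ Q.binders, c ∉ P.free := by
  obtain ⟨hn, hf⟩ := h
  simp only [Proc.binders, List.nodup_append, List.mem_append, Proc.free, Set.mem_union,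
    not_or] at hn hf
  exact ⟨⟨hn.1, fun c hc => (hf c (Or.inl hc)).1⟩, ⟨hn.2.1, fun c hc => (hf c (Or.inr hc)).2⟩,
    fun c hc => (hf c (Or.inl hc)).2, fun c hc => (hf c (Or.inr hc)).1⟩

theorem Proc.BoundDistinct.of_res {a : Name} {P : Proc Atom} (h : (Proc.res a P).BoundDistinct) :
    P.BoundDistinct ∧ .name a ∉ P.binders := by
  obtain ⟨hn, hf⟩ := h
  simp only [Proc.binders, List.nodup_cons] at hn hf
  refine ⟨⟨hn.2, fun c hc hc' => hf c (List.mem_cons_of_mem _ hc) ⟨hc', ?_⟩⟩, hn.1⟩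
  rintro rfl
  exact hn.1 hc

/-! ### Extending a history by an action -/

/-- The causes in `κ` of the vertices of `V` at and above the address `d`: the cause set of an
action that is executed there. -/
def causesAt (V : Set Vertex) (κ : Causes) (d : List Bool) : Set Key :=
  {m | ∃ u ∈ V, u.1 <+: d ∧ m ∈ κ u.1}

/-- A history `V` with cause sets `κ` grows to `V'` with cause sets `κ'` when an action with cause
set `K` is executed: the action adds vertices with key `i` at the addresses in `D`, and in addition
to the causes of the action these vertices have the causes in `E`. -/
structure HistoryExt (V V' : Set Vertex) (κ κ' : Causes) (i : Key) (D : Set (List Bool))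
    (K E : Set Key) : Prop where
  mem_iff : ∀ v, v ∈ V' ↔ v ∈ V ∨ v.1 ∈ D ∧ v.2 = i
  leaf : ∀ d ∈ D, ∀ u ∈ V, ¬ d <+: u.1
  agree : ∀ u ∈ V, κ' u.1 = κ u.1
  causes : K = ⋃ d ∈ D, causesAt V κ d
  new : ∀ d ∈ D, causesAt V κ d ∪ κ' d = K ∪ E

theorem causesAt_push (W V : Set Vertex) (κ : Causes) {t : Bool} (hW : ∀ u ∈ W, ¬ [t] <+: u.1)
    (d : List Bool) :
    causesAt (W ∪ Vertex.push t '' V) κ (t :: d) = causesAt W κ [] ∪ causesAt V (κ.below t) d := by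
  have hroot : ∀ u ∈ W, u.1 <+: t :: d ↔ u.1 <+: [] := fun u hu => by
    rcases h : u.1 with _ | ⟨s, l⟩
    · simp
    · simpa using fun hs => absurd (by simp [h, hs]) (hW u hu)
  ext m
  simp only [causesAt, Set.mem_ofPred_eq, Set.mem_union, or_and_right, exists_or,
    Set.exists_mem_image, Vertex.push, List.cons_prefix_cons, true_and, Causes.below]
  exact or_congr_left (exists_congr fun u => and_congr_right fun hu => by rw [hroot u hu])

theorem causesAt_push_nil (t : Bool) (V : Set Vertex) (κ : Causes) :
    causesAt (Vertex.push t '' V) κ [] = ∅ := by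
  simp [causesAt, Vertex.push]

theorem not_prefix_push {s t : Bool} (hst : s ≠ t) (V : Set Vertex) :
    ∀ u ∈ Vertex.push t '' V, ¬ [s] <+: u.1 := by
  rintro _ ⟨u, -, rfl⟩ hp
  exact hst (List.cons_prefix_cons.1 hp).1

theorem causesAt_par_true (V W : Set Vertex) (κ : Causes) (d : List Bool) :
    causesAt (Vertex.push false '' V ∪ Vertex.push true '' W) κ (true :: d) =
      causesAt W (κ.below true) d := by
  rw [causesAt_push _ _ _ (not_prefix_push (by decide) V), causesAt_push_nil, Set.empty_union]

theorem causesAt_par_false (V W : Set Vertex) (κ : Causes) (d : List Bool) :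
    causesAt (Vertex.push false '' V ∪ Vertex.push true '' W) κ (false :: d) =
      causesAt V (κ.below false) d := by
  rw [Set.union_comm, causesAt_push _ _ _ (not_prefix_push (by decide) W), causesAt_push_nil,
    Set.empty_union]

namespace HistoryExt

variable {V V' W W' : Set Vertex} {κ κ' κ₁ κ₂ : Causes} {i k : Key} {D D' : Set (List Bool)}
  {d : List Bool} {K L E : Set Key}

theorem single (hleaf : ∀ u ∈ V, ¬ d <+: u.1) (hagree : ∀ u ∈ V, κ' u.1 = κ u.1)
    (hd : κ' d = E) : HistoryExt V (V ∪ {(d, i)}) κ κ' i {d} (causesAt V κ d) E where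
  mem_iff v := by simp [Prod.ext_iff, or_comm]
  leaf := by rintro _ rfl; exact hleaf
  agree := hagree
  causes := by simp
  new := by rintro _ rfl; rw [hd]

theorem mem_push (h : HistoryExt V V' κ κ' i D K E) {t : Bool} {v : Vertex} :
    v ∈ Vertex.push t '' V' ↔ v ∈ Vertex.push t '' V ∨ v.1 ∈ List.cons t '' D ∧ v.2 = i := by
  constructor
  · rintro ⟨u, hu, rfl⟩
    exact ((h.mem_iff u).1 hu).imp (Set.mem_image_of_mem _)
      (And.imp_left (Set.mem_image_of_mem _))
  · rintro (⟨u, hu, rfl⟩ | ⟨⟨d, hd, hdv⟩, hi⟩)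
    · exact ⟨u, (h.mem_iff u).2 (Or.inl hu), rfl⟩
    · exact ⟨(d, i), (h.mem_iff _).2 (Or.inr ⟨hd, rfl⟩), Prod.ext hdv hi.symm⟩

theorem lift {t : Bool} (hW : ∀ u ∈ W, ¬ [t] <+: u.1) (hD : D.Nonempty)
    (h : HistoryExt V V' (κ.below t) κ₁ i D K E) :
    HistoryExt (W ∪ Vertex.push t '' V) (W ∪ Vertex.push t '' V') κ (κ.graft t κ₁) i
      (List.cons t '' D) (causesAt W κ [] ∪ K) E where
  mem_iff v := by
    rw [Set.mem_union, Set.mem_union, h.mem_push, or_assoc]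
  leaf := by
    rintro _ ⟨d, hd, rfl⟩ u (hu | ⟨u, hu, rfl⟩) hp
    · exact hW u hu ((List.prefix_append [t] d).trans hp)
    · exact h.leaf d hd u hu (List.cons_prefix_cons.1 hp).2
  agree := by
    rintro u (hu | ⟨u, hu, rfl⟩)
    · exact κ.graft_of_not_isPrefix κ₁ (hW u hu)
    · exact (κ.graft_cons_self t κ₁ u.1).trans (h.agree u hu)
  causes := by
    simp only [Set.biUnion_image, causesAt_push W V κ hW, h.causes]
    exact sup_biSup hD
  new := by
    rintro _ ⟨d, hd, rfl⟩
    rw [causesAt_push W V κ hW, κ.graft_cons_self, Set.union_assoc, h.new d hd, Set.union_assoc]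

theorem replace (h : HistoryExt V V' κ κ' i {d} K {k}) (hd : κ' d = {k})
    (hk : ∀ u ∈ V, k ∉ κ u.1) (L : Set Key) :
    HistoryExt V V' κ (fun l => replaceKey k L (κ' l)) i {d} K L where
  mem_iff := h.mem_iff
  leaf := h.leaf
  agree u hu := by
    rw [h.agree u hu, replaceKey_of_notMem L (hk u hu)]
  causes := h.causes
  new := by
    rintro _ rfl
    rw [hd, replaceKey_singleton, h.causes, Set.biUnion_singleton]

theorem par (h₁ : HistoryExt V V' (κ.below false) κ₁ i D K L)
    (h₂ : HistoryExt W W' (κ.below true) κ₂ i D' L K) :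
    HistoryExt (Vertex.push false '' V ∪ Vertex.push true '' W)
      (Vertex.push false '' V' ∪ Vertex.push true '' W') κ ((κ.graft false κ₁).graft true κ₂) i
      (List.cons false '' D ∪ List.cons true '' D') (K ∪ L) ∅ where
  mem_iff v := by
    simp only [Set.mem_union, h₁.mem_push, h₂.mem_push]
    tauto
  leaf := by
    rintro _ (⟨d, hd, rfl⟩ | ⟨d, hd, rfl⟩) _ (⟨u, hu, rfl⟩ | ⟨u, hu, rfl⟩) hp
    · exact h₁.leaf d hd u hu (List.cons_prefix_cons.1 hp).2
    · cases (List.cons_prefix_cons.1 hp).1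
    · cases (List.cons_prefix_cons.1 hp).1
    · exact h₂.leaf d hd u hu (List.cons_prefix_cons.1 hp).2
  agree := by
    rintro _ (⟨u, hu, rfl⟩ | ⟨u, hu, rfl⟩)
    · exact h₁.agree u hu
    · exact h₂.agree u hu
  causes := by
    simp only [Set.biUnion_union, Set.biUnion_image, causesAt_par_false, causesAt_par_true,
      h₁.causes, h₂.causes]
  new := by
    rintro _ (⟨d, hd, rfl⟩ | ⟨d, hd, rfl⟩)
    · rw [causesAt_par_false, Set.union_empty]
      exact h₁.new d hd
    · rw [causesAt_par_true, Set.union_empty, Set.union_comm K]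
      exact h₂.new d hd

end HistoryExt

/-- The cause sets `κ` of the vertices added by an action with label `ζ` at the addresses `D`: a
visible action adds one vertex, whose cause set is the key of the action, and a synchronisation adds
several vertices. -/
def BLabel.Creates (κ : Causes) (D : Set (List Bool)) : BLabel → Prop
  | .vis k _ => ∃ d, D = {d} ∧ κ d = {k}
  | .tau => D.Nontrivial

/-- An action with label `ζ` and cause set `K` extends a history `V` with cause sets `κ` to `V'`
with `κ'`. The key `i` of the new vertices need not be the key that `ζ` shows: a process and its
causal reading choose the intermediate key of a synchronisation independently. -/
def Grows (V V' : Set Vertex) (κ κ' : Causes) (i : Key) (ζ : BLabel) (K : Set Key) : Prop :=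
  ∃ D, HistoryExt V V' κ κ' i D K ζ.keys ∧ ζ.Creates κ' D

theorem BLabel.Creates.nonempty {κ : Causes} {D : Set (List Bool)} {ζ : BLabel}
    (h : ζ.Creates κ D) : D.Nonempty := by
  cases ζ with
  | vis k π =>
    obtain ⟨d, rfl, -⟩ := h
    exact Set.singleton_nonempty d
  | tau => exact Set.Nontrivial.nonempty h

theorem BLabel.Creates.graft {κ κ₁ : Causes} {D : Set (List Bool)} {ζ : BLabel}
    (h : ζ.Creates κ₁ D) (t : Bool) : ζ.Creates (κ.graft t κ₁) (List.cons t '' D) := by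
  cases ζ with
  | vis k π =>
    obtain ⟨d, rfl, hd⟩ := h
    exact ⟨t :: d, Set.image_singleton, (κ.graft_cons_self t κ₁ d).trans hd⟩
  | tau => exact Set.Nontrivial.image h List.cons_injective

namespace Grows

variable {V V' W W' : Set Vertex} {κ κ₁ κ₂ : Causes} {i k : Key} {ζ : BLabel} {π ρ : BAct}
  {K L : Set Key}

theorem root (κ : Causes) (i k : Key) (π : BAct) :
    Grows ∅ {([], i)} κ (fun _ => {k}) i (.vis k π) ∅ := by
  have h := HistoryExt.single (V := ∅) (κ := κ) (κ' := fun _ => {k}) (i := i) (d := [])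
    (E := {k}) (by simp) (by simp) rfl
  simp only [Set.empty_union, causesAt, Set.mem_empty_iff_false, false_and, exists_false,
    Set.ofPred_false] at h
  exact ⟨{[]}, h, [], rfl, rfl⟩

theorem lift {t : Bool} (hW : ∀ u ∈ W, ¬ [t] <+: u.1) (h : Grows V V' (κ.below t) κ₁ i ζ K) :
    Grows (W ∪ Vertex.push t '' V) (W ∪ Vertex.push t '' V') κ (κ.graft t κ₁) i ζ
      (causesAt W κ [] ∪ K) := by
  obtain ⟨D, hext, hD⟩ := h
  exact ⟨_, hext.lift hW hD.nonempty, hD.graft t⟩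

theorem past (k : Key) (h : Grows V V' (κ.below false) κ₁ i ζ K) :
    Grows ({([], k)} ∪ Vertex.push false '' V) ({([], k)} ∪ Vertex.push false '' V') κ
      (κ.graft false κ₁) i ζ (κ [] ∪ K) := by
  have hroot : causesAt {([], k)} κ [] = κ [] := by simp [causesAt]
  exact hroot ▸ h.lift (by simp)

theorem parL (W : Set Vertex) (h : Grows V V' (κ.below false) κ₁ i ζ K) :
    Grows (Vertex.push false '' V ∪ Vertex.push true '' W)
      (Vertex.push false '' V' ∪ Vertex.push true '' W) κ (κ.graft false κ₁) i ζ K := by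
  simpa only [Set.union_comm, causesAt_push_nil, Set.union_empty] using
    h.lift (not_prefix_push Bool.false_ne_true W)

theorem parR (W : Set Vertex) (h : Grows V V' (κ.below true) κ₁ i ζ K) :
    Grows (Vertex.push false '' W ∪ Vertex.push true '' V)
      (Vertex.push false '' W ∪ Vertex.push true '' V') κ (κ.graft true κ₁) i ζ K := by
  simpa only [causesAt_push_nil, Set.empty_union] using
    h.lift (not_prefix_push Bool.false_ne_true.symm W)

theorem synchronise (hV : Grows V V' (κ.below false) κ₁ i (.vis k π) K)
    (hW : Grows W W' (κ.below true) κ₂ i (.vis k ρ) L)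
    (hkV : ∀ u ∈ V, k ∉ κ.below false u.1) (hkW : ∀ u ∈ W, k ∉ κ.below true u.1) :
    Grows (Vertex.push false '' V ∪ Vertex.push true '' W)
      (Vertex.push false '' V' ∪ Vertex.push true '' W') κ
      ((κ.graft false fun l => replaceKey k L (κ₁ l)).graft true fun l => replaceKey k K (κ₂ l)) i
      .tau (K ∪ L) := by
  obtain ⟨_, hext₁, d, rfl, hd⟩ := hV
  obtain ⟨_, hext₂, e, rfl, he⟩ := hW
  exact ⟨_, (hext₁.replace hd hkV L).par (hext₂.replace he hkW K),
    ⟨false :: d, by simp, true :: e, by simp, by simp⟩⟩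

end Grows

/-! ### Coherent processes -/

namespace RProc

/-- No restriction with non-empty memory has a binder of its name in its scope. Such a restriction
no longer binds anything, so the convention on bound names says nothing about it. -/
def NoShadowing : RProc → Prop
  | .nil => True
  | .out _ _ _ => True
  | .inp _ _ _ => True
  | .pastOut _ _ _ _ X => X.NoShadowing
  | .pastInp _ _ _ _ X => X.NoShadowing
  | .par X Y => X.NoShadowing ∧ Y.NoShadowing
  | .res a δ X => (¬ δ.Empty → .name a ∉ X.erase.binders) ∧ X.NoShadowing

theorem noShadowing_ofProc (P : Proc DAtom) : (ofProc P).NoShadowing := by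
  induction P with
  | res _ _ ih => exact ⟨absurd Mem.init_empty, ih⟩
  | _ => simp_all [ofProc, NoShadowing]

theorem NoShadowing.subst {X : RProc} (h : X.NoShadowing) (x : Var) (v : Atom) (i : Key) :
    (X.subst x v i).NoShadowing := by
  induction X with
  | res => simp_all [RProc.subst, NoShadowing, binders_erase_subst]
  | _ => simp_all [RProc.subst, NoShadowing]

theorem NoShadowing.updateCause {X : RProc} (h : X.NoShadowing) (i : Key) (K K' : Set SKey) :
    (X.updateCause i K K').NoShadowing := by
  induction X with
  | res => simp_all [RProc.updateCause, NoShadowing, erase_updateCause]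
  | _ => simp_all [RProc.updateCause, NoShadowing]

theorem NoShadowing.sharp {X : RProc} (h : X.NoShadowing) (hok : X.MemOk) (i : Key) :
    (X.sharp i).NoShadowing := by
  induction X with
  | res => simp_all [RProc.sharp, NoShadowing, MemOk, Mem.Ok.empty_sharp_iff, MemOk.erase_sharp]
  | _ => simp_all [RProc.sharp, NoShadowing, MemOk]

/-- The invariant on single processes along a trace: memories are consistent, and bound names and
variables are distinct from each other and from the free ones. -/
structure Coherent (X : RProc) : Prop where
  memOk : X.MemOk
  noShadowing : X.NoShadowing
  boundDistinct : X.erase.BoundDistinct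

theorem coherent_initial {P : Proc Atom} (h : P.BoundDistinct) : (initial P).Coherent where
  memOk := memOk_ofProc _
  noShadowing := noShadowing_ofProc _
  boundDistinct := by
    rwa [← erase_toC _ fun _ => ∅, toC_initial, CProc.erase_ofProc]

namespace Coherent

variable {X Y : RProc} {a : Name} {δ : Mem}

theorem left (h : (RProc.par X Y).Coherent) : X.Coherent :=
  ⟨h.memOk.1, h.noShadowing.1, h.boundDistinct.of_par.1⟩

theorem right (h : (RProc.par X Y).Coherent) : Y.Coherent :=
  ⟨h.memOk.2, h.noShadowing.2, h.boundDistinct.of_par.2.1⟩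

theorem pastOut {b a : DAtom} {k : Key} {K : Set SKey} (h : (RProc.pastOut b a k K X).Coherent) :
    X.Coherent := ⟨h.memOk, h.noShadowing, h.boundDistinct⟩

theorem pastInp {b : DAtom} {x : Var} {k : Key} {K : Set SKey}
    (h : (RProc.pastInp b x k K X).Coherent) : X.Coherent :=
  ⟨h.memOk, h.noShadowing, h.boundDistinct⟩

theorem res (h : (RProc.res a δ X).Coherent) : X.Coherent := by
  refine ⟨h.memOk.2, h.noShadowing.2, ?_⟩
  have hbd := h.boundDistinct
  unfold erase at hbd
  split_ifs at hbd
  exacts [hbd.of_res.1, hbd]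

theorem notMem_binders (h : (RProc.res a δ X).Coherent) : .name a ∉ X.erase.binders := by
  by_cases hδ : δ.Empty
  · have hbd := h.boundDistinct
    rw [erase, if_pos hδ] at hbd
    exact hbd.of_res.2
  · exact h.noShadowing.1 hδ

end Coherent

end RProc

/-! ### Labels -/

theorem keys_gamma (μ : FLabel) : (gamma μ).keys ⊆ {μ.key} := by
  rcases μ with ⟨i, K, j, _ | _ | _ | _⟩ <;> simp [gamma, BLabel.keys]

theorem atoms_gamma (μ : FLabel) : (gamma μ).atoms = μ.act.atoms := by
  rcases μ with ⟨i, K, j, _ | _ | ⟨b, a, δ⟩ | _⟩ <;>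
    simp only [gamma, BLabel.atoms, FAct.atoms]
  split_ifs <;> rfl

theorem gamma_bout_of_empty {i : Key} {K : Set SKey} {j : SKey} {b : Atom} {a : Name} {δ : Mem}
    (h : δ.Empty) : gamma ⟨i, K, j, .bout b a δ⟩ = .vis i (.bout b a) := by
  simp [gamma, h]

theorem gamma_bout_of_not_empty {i : Key} {K : Set SKey} {j : SKey} {b : Atom} {a : Name}
    {δ : Mem} (h : ¬ δ.Empty) :
    gamma ⟨i, K, j, .bout b a δ⟩ = .vis i (.out b (.name a)) := by
  simp [gamma, h]

theorem gamma_of_output {i : Key} {K : Set SKey} {j : SKey} {b : Atom} {a : Name} {π : FAct}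
    (hπ : π = .out b (.name a) ∨ ∃ δ, π = .bout b a δ)
    (ha : .name a ∉ (gamma ⟨i, K, j, π⟩).bound) :
    gamma ⟨i, K, j, π⟩ = .vis i (.out b (.name a)) := by
  rcases hπ with rfl | ⟨δ, rfl⟩
  · rfl
  · refine gamma_bout_of_not_empty fun hδ => ha ?_
    rw [gamma_bout_of_empty hδ]
    rfl

/-! ### Actions read causally -/

/-- An action of `X` with key `i`, which leads to `X'`, is read as a causal action with label `ζ`
and cause set `K`, which leads to `A`: the history grows accordingly, and `A` is the causal process
of `X'` for the new cause sets. -/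
def ReadsAs (X X' : RProc) (κ : Causes) (i : Key) (ζ : BLabel) (K : Set Key) (A : CProc) : Prop :=
  ∃ κ', Grows X.vertices X'.vertices κ κ' i ζ K ∧ X'.toC κ' = A

namespace ReadsAs

variable {X X' X'' Y Y' : RProc} {κ : Causes} {i k : Key} {ζ : BLabel} {π ρ : BAct} {K L : Set Key}
  {A B : CProc}

theorem congr_right (h : ReadsAs X X' κ i ζ K A) (hv : X''.vertices = X'.vertices)
    (hc : ∀ κ, X''.toC κ = X'.toC κ) : ReadsAs X X'' κ i ζ K A := by
  obtain ⟨κ', hg, rfl⟩ := h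
  exact ⟨κ', hv ▸ hg, hc κ'⟩

theorem updateCause (h : ReadsAs X X' κ i ζ K A) (j : Key) (S S' : Set SKey) :
    ReadsAs X (X'.updateCause j S S') κ i ζ K A :=
  h.congr_right (X'.vertices_updateCause j S S') (X'.toC_updateCause j S S')

theorem sharp (h : ReadsAs X X' κ i ζ K A) (hX' : X'.MemOk) (j : Key) :
    ReadsAs X (X'.sharp j) κ i ζ K A :=
  h.congr_right (X'.vertices_sharp j) (hX'.toC_sharp j)

theorem subst (h : ReadsAs X X' κ i ζ K A) (x : Var) (v : Atom) (j : Key) :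
    ReadsAs X (X'.subst x v j) κ i ζ K (A.subst x v) := by
  obtain ⟨κ', hg, rfl⟩ := h
  exact ⟨κ', X'.vertices_subst x v j ▸ hg, X'.toC_subst κ' x v j⟩

theorem out (b a : DAtom) (P : Proc DAtom) (κ : Causes) (i : Key) (S : Set SKey) (k : Key)
    (π : BAct) : ReadsAs (.out b a P) (.pastOut b a i S (RProc.ofProc P)) κ i (.vis k π) ∅
      (.cause {k} (CProc.ofProc (P.map Prod.fst))) := by
  refine ⟨fun _ => {k}, ?_, congrArg (CProc.cause {k}) (RProc.toC_ofProc P _)⟩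
  rw [RProc.vertices_out, RProc.vertices_pastOut, RProc.vertices_ofProc, Set.image_empty,
    Set.union_empty]
  exact Grows.root κ i k π

theorem inp (b : DAtom) (x : Var) (P : Proc DAtom) (κ : Causes) (i : Key) (S : Set SKey) (k : Key)
    (π : BAct) : ReadsAs (.inp b x P) (.pastInp b x i S (RProc.ofProc P)) κ i (.vis k π) ∅
      (.cause {k} (CProc.ofProc (P.map Prod.fst))) := by
  refine ⟨fun _ => {k}, ?_, congrArg (CProc.cause {k}) (RProc.toC_ofProc P _)⟩
  rw [RProc.vertices_inp, RProc.vertices_pastInp, RProc.vertices_ofProc, Set.image_empty,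
    Set.union_empty]
  exact Grows.root κ i k π

theorem pastOut (h : ReadsAs X X' (κ.below false) i ζ K A) (b a : DAtom) (j : Key) (S : Set SKey) :
    ReadsAs (.pastOut b a j S X) (.pastOut b a j S X') κ i ζ (κ [] ∪ K) (.cause (κ []) A) := by
  obtain ⟨κ', hg, rfl⟩ := h
  refine ⟨κ.graft false κ', ?_, by simp [RProc.toC]⟩
  simpa only [RProc.vertices_pastOut] using hg.past j

theorem pastInp (h : ReadsAs X X' (κ.below false) i ζ K A) (b : DAtom) (x : Var) (j : Key)
    (S : Set SKey) :
    ReadsAs (.pastInp b x j S X) (.pastInp b x j S X') κ i ζ (κ [] ∪ K) (.cause (κ []) A) := by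
  obtain ⟨κ', hg, rfl⟩ := h
  refine ⟨κ.graft false κ', ?_, by simp [RProc.toC]⟩
  simpa only [RProc.vertices_pastInp] using hg.past j

theorem parL (h : ReadsAs X X' (κ.below false) i ζ K A) (Y : RProc) :
    ReadsAs (.par X Y) (.par X' Y) κ i ζ K (.par A (Y.toC (κ.below true))) := by
  obtain ⟨κ', hg, rfl⟩ := h
  refine ⟨κ.graft false κ', ?_, by simp [RProc.toC]⟩
  simpa only [RProc.vertices_par] using hg.parL Y.vertices

theorem parR (h : ReadsAs X X' (κ.below true) i ζ K A) (Y : RProc) :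
    ReadsAs (.par Y X) (.par Y X') κ i ζ K (.par (Y.toC (κ.below false)) A) := by
  obtain ⟨κ', hg, rfl⟩ := h
  refine ⟨κ.graft true κ', ?_, by simp [RProc.toC]⟩
  simpa only [RProc.vertices_par] using hg.parR Y.vertices

theorem res {a : Name} {δ : Mem} (h : ReadsAs X X' κ i ζ K A) (hδ : δ.Empty) :
    ReadsAs (.res a δ X) (.res a δ X') κ i ζ K (.res a A) := by
  obtain ⟨κ', hg, rfl⟩ := h
  exact ⟨κ', hg, RProc.toC_res_of_empty hδ X' κ'⟩

theorem res_of_not_empty {a : Name} {δ' : Mem} (h : ReadsAs X X' κ i ζ K A) (δ : Mem)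
    (hδ' : ¬ δ'.Empty) : ReadsAs (.res a δ X) (.res a δ' X') κ i ζ K A := by
  obtain ⟨κ', hg, rfl⟩ := h
  exact ⟨κ', hg, RProc.toC_res_of_not_empty hδ' X' κ'⟩

theorem synchronise (hX : ReadsAs X X' (κ.below false) i (.vis k π) K A)
    (hY : ReadsAs Y Y' (κ.below true) i (.vis k ρ) L B)
    (hkX : k ∉ (X.toC (κ.below false)).keys) (hkY : k ∉ (Y.toC (κ.below true)).keys) :
    ReadsAs (.par X Y) (.par X' Y') κ i .tau (K ∪ L)
      (.par (A.replaceCause k L) (B.replaceCause k K)) := by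
  obtain ⟨κ₁, hg₁, rfl⟩ := hX
  obtain ⟨κ₂, hg₂, rfl⟩ := hY
  simp only [RProc.mem_keys_toC, not_exists, not_and] at hkX hkY
  have hg := hg₁.synchronise hg₂ hkX hkY
  simp only [← RProc.vertices_par] at hg
  exact ⟨_, hg, by simp [RProc.toC, RProc.toC_replaceCause]⟩

end ReadsAs

/-! ### From reversible to causal transitions -/

/-- The causal process of `X` has a transition with label `ζ` as which the action of `X` with key
`i` that leads to `X'` can be read. -/
def Mirrors (X X' : RProc) (κ : Causes) (i : Key) (ζ : BLabel) : Prop :=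
  ∃ K A, BStep (X.toC κ) K ζ A ∧ ReadsAs X X' κ i ζ K A

namespace Mirrors

variable {X X' Y Y' : RProc} {κ : Causes} {i k : Key} {ζ : BLabel}

theorem bound_subset (h : Mirrors X X' κ i ζ) : ∀ c ∈ ζ.bound, c ∈ X.erase.binders := by
  obtain ⟨K, A, hs, -⟩ := h
  simpa only [RProc.erase_toC] using hs.bound_subset

theorem updateCause (h : Mirrors X X' κ i ζ) (j : Key) (S S' : Set SKey) :
    Mirrors X (X'.updateCause j S S') κ i ζ := by
  obtain ⟨K, A, hs, hr⟩ := h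
  exact ⟨K, A, hs, hr.updateCause j S S'⟩

theorem sharp (h : Mirrors X X' κ i ζ) (hX' : X'.MemOk) (j : Key) :
    Mirrors X (X'.sharp j) κ i ζ := by
  obtain ⟨K, A, hs, hr⟩ := h
  exact ⟨K, A, hs, hr.sharp hX' j⟩

theorem pastOut (h : Mirrors X X' (κ.below false) i ζ) (b a : DAtom) (j : Key) (S : Set SKey)
    (hζ : Disjoint ζ.keys (κ [])) : Mirrors (.pastOut b a j S X) (.pastOut b a j S X') κ i ζ := by
  obtain ⟨K, A, hs, hr⟩ := h
  exact ⟨_, _, .cau _ _ _ _ _ hs hζ, hr.pastOut b a j S⟩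

theorem pastInp (h : Mirrors X X' (κ.below false) i ζ) (b : DAtom) (x : Var) (j : Key)
    (S : Set SKey) (hζ : Disjoint ζ.keys (κ [])) :
    Mirrors (.pastInp b x j S X) (.pastInp b x j S X') κ i ζ := by
  obtain ⟨K, A, hs, hr⟩ := h
  exact ⟨_, _, .cau _ _ _ _ _ hs hζ, hr.pastInp b x j S⟩

theorem parL (h : Mirrors X X' (κ.below false) i ζ) (hXY : (RProc.par X Y).Coherent)
    (hζ : Disjoint ζ.keys (Y.toC (κ.below true)).keys) :
    Mirrors (.par X Y) (.par X' Y) κ i ζ := by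
  have hbound : Disjoint ζ.bound (Y.toC (κ.below true)).free := by
    rw [RProc.free_toC]
    exact Set.disjoint_left.2 fun c hc =>
      hXY.boundDistinct.of_par.2.2.1 c (h.bound_subset c hc)
  obtain ⟨K, A, hs, hr⟩ := h
  exact ⟨K, _, .parL _ _ _ _ _ hs hζ hbound, hr.parL Y⟩

theorem parR (h : Mirrors Y Y' (κ.below true) i ζ) (hXY : (RProc.par X Y).Coherent)
    (hζ : Disjoint ζ.keys (X.toC (κ.below false)).keys) :
    Mirrors (.par X Y) (.par X Y') κ i ζ := by
  have hbound : Disjoint ζ.bound (X.toC (κ.below false)).free := by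
    rw [RProc.free_toC]
    exact Set.disjoint_left.2 fun c hc =>
      hXY.boundDistinct.of_par.2.2.2 c (h.bound_subset c hc)
  obtain ⟨K, A, hs, hr⟩ := h
  exact ⟨K, _, .parR _ _ _ _ _ hs hζ hbound, hr.parR X⟩

theorem res_of_not_empty {a : Name} {δ δ' : Mem} (h : Mirrors X X' κ i ζ) (hδ : ¬ δ.Empty)
    (hδ' : ¬ δ'.Empty) : Mirrors (.res a δ X) (.res a δ' X') κ i ζ := by
  obtain ⟨K, A, hs, hr⟩ := h
  exact ⟨K, A, (RProc.toC_res_of_not_empty hδ X κ).symm ▸ hs, hr.res_of_not_empty δ hδ'⟩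

theorem res {a : Name} (h : Mirrors X X' κ i ζ) (δ : Mem) (ha : .name a ∉ ζ.atoms) :
    Mirrors (.res a δ X) (.res a δ X') κ i ζ := by
  by_cases hδ : δ.Empty
  · obtain ⟨K, A, hs, hr⟩ := h
    exact ⟨K, _, (RProc.toC_res_of_empty hδ X κ).symm ▸ .res _ _ _ _ _ hs ha, hr.res hδ⟩
  · exact h.res_of_not_empty hδ hδ

theorem extrude {a : Name} {b : Atom} {δ δ' : Mem}
    (h : Mirrors X X' κ i (.vis k (.out b (.name a))))
    (hδ : δ.Empty) (hδ' : ¬ δ'.Empty) (hb : b ≠ .name a) :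
    Mirrors (.res a δ X) (.res a δ' X') κ i (.vis k (.bout b a)) := by
  obtain ⟨K, A, hs, hr⟩ := h
  exact ⟨K, A, (RProc.toC_res_of_empty hδ X κ).symm ▸ .open _ _ _ _ _ _ hs hb,
    hr.res_of_not_empty δ hδ'⟩

theorem comL {b a : Atom} {x : Var} (hX : Mirrors X X' (κ.below false) i (.vis k (.out b a)))
    (hY : Mirrors Y Y' (κ.below true) i (.vis k (.inp b x))) :
    Mirrors (.par X Y) (.par X' (Y'.subst x a i)) κ i .tau := by
  obtain ⟨K, A, hs, hr⟩ := hX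
  obtain ⟨L, B, ht, hq⟩ := hY
  exact ⟨_, _, .comL _ _ _ _ _ _ _ _ _ _ hs ht,
    hr.synchronise (hq.subst x a i) hs.key_notMem ht.key_notMem⟩

theorem comR {b a : Atom} {x : Var} (hX : Mirrors X X' (κ.below true) i (.vis k (.out b a)))
    (hY : Mirrors Y Y' (κ.below false) i (.vis k (.inp b x))) :
    Mirrors (.par Y X) (.par (Y'.subst x a i) X') κ i .tau := by
  obtain ⟨K, A, hs, hr⟩ := hX
  obtain ⟨L, B, ht, hq⟩ := hY
  refine ⟨K ∪ L, _, .comR _ _ _ _ _ _ _ _ _ _ hs ht, Set.union_comm L K ▸ ?_⟩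
  exact (hq.subst x a i).synchronise hr ht.key_notMem hs.key_notMem

theorem closeL {S : Set SKey} {j : SKey} {b : Atom} {a : Name} {δ : Mem} {x : Var}
    (hX : Mirrors X X' (κ.below false) i (gamma ⟨i, S, j, .bout b a δ⟩))
    (hY : Mirrors Y Y' (κ.below true) i (.vis i (.inp b x))) (hXY : (RProc.par X Y).Coherent) :
    Mirrors (.par X Y) (.res a δ (.par X' (Y'.subst x (.name a) i))) κ i .tau := by
  by_cases hδ : δ.Empty
  · rw [gamma_bout_of_empty hδ] at hX
    have ha : .name a ∉ (Y.toC (κ.below true)).free := by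
      rw [RProc.free_toC]
      exact hXY.boundDistinct.of_par.2.2.1 _ (hX.bound_subset _ rfl)
    obtain ⟨K, A, hs, hr⟩ := hX
    obtain ⟨L, B, ht, hq⟩ := hY
    refine ⟨_, _, .closeL _ _ _ _ _ _ _ _ _ _ hs ht ha, ReadsAs.res (X := X.par Y) ?_ hδ⟩
    exact hr.synchronise (hq.subst x (.name a) i) hs.key_notMem ht.key_notMem
  · rw [gamma_bout_of_not_empty hδ] at hX
    obtain ⟨K, A, hs, hr⟩ := hX.comL hY
    exact ⟨K, A, hs, hr.res_of_not_empty δ hδ⟩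

theorem closeR {S : Set SKey} {j : SKey} {b : Atom} {a : Name} {δ : Mem} {x : Var}
    (hX : Mirrors X X' (κ.below true) i (gamma ⟨i, S, j, .bout b a δ⟩))
    (hY : Mirrors Y Y' (κ.below false) i (.vis i (.inp b x))) (hYX : (RProc.par Y X).Coherent) :
    Mirrors (.par Y X) (.res a δ (.par (Y'.subst x (.name a) i) X')) κ i .tau := by
  by_cases hδ : δ.Empty
  · rw [gamma_bout_of_empty hδ] at hX
    have ha : .name a ∉ (Y.toC (κ.below false)).free := by
      rw [RProc.free_toC]
      exact hYX.boundDistinct.of_par.2.2.2 _ (hX.bound_subset _ rfl)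
    obtain ⟨K, A, hs, hr⟩ := hX
    obtain ⟨L, B, ht, hq⟩ := hY
    refine ⟨K ∪ L, _, .closeR _ _ _ _ _ _ _ _ _ _ hs ht ha,
      ReadsAs.res (X := Y.par X) (Set.union_comm L K ▸ ?_) hδ⟩
    exact (hq.subst x (.name a) i).synchronise hr ht.key_notMem hs.key_notMem
  · rw [gamma_bout_of_not_empty hδ] at hX
    obtain ⟨K, A, hs, hr⟩ := hX.comR hY
    exact ⟨K, A, hs, hr.res_of_not_empty δ hδ⟩

end Mirrors

theorem disjoint_keys_gamma {μ : FLabel} {S : Set Key} (h : μ.key ∉ S) :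
    Disjoint (gamma μ).keys S :=
  (Set.disjoint_singleton_left.2 h).mono_left (keys_gamma μ)

theorem RProc.keys_toC_res (a : Name) (δ : Mem) (X : RProc) (κ : Causes) :
    ((RProc.res a δ X).toC κ).keys = (X.toC κ).keys := by
  ext m
  rw [mem_keys_toC, mem_keys_toC]
  rfl

theorem Mirrors.extrude_gamma {X X' : RProc} {κ : Causes} {i : Key} {S S' : Set SKey} {j : SKey}
    {π : FAct} {b : Atom} {a : Name} {δ : Mem} (h : Mirrors X X' κ i (gamma ⟨i, S, j, π⟩))
    (hπ : π = .out b (.name a) ∨ ∃ δ', π = .bout b a δ') (hb : δ.Empty → b ≠ .name a)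
    (ha : .name a ∉ X.erase.binders) :
    Mirrors (.res a δ X) (.res a (δ.add i) X') κ i (gamma ⟨i, S', j, .bout b a δ⟩) := by
  rw [gamma_of_output hπ fun hbound => ha (h.bound_subset _ hbound)] at h
  by_cases hδ : δ.Empty
  · exact gamma_bout_of_empty hδ ▸ h.extrude hδ (δ.not_empty_add i) (hb hδ)
  · exact gamma_bout_of_not_empty hδ ▸ h.res_of_not_empty hδ (δ.not_empty_add i)

theorem FStep.mirrors {X X' : RProc} {μ : FLabel} (h : FStep X μ X') (hX : X.Coherent) :
    ∀ κ, μ.key ∉ (X.toC κ).keys → Mirrors X X' κ μ.key (gamma μ) := by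
  induction h with
  | out1 b a P i S => exact fun κ _ => ⟨_, _, .out _ _ _ i, .out b a P κ i S i _⟩
  | in1 b x P i S => exact fun κ _ => ⟨_, _, .inp _ _ _ i, .inp b x P κ i S i _⟩
  | out2 b a k S _ _ _ _ _ ih =>
    exact fun κ hi => (ih hX.pastOut _ (mt .inr hi)).pastOut b a k S
      (disjoint_keys_gamma (mt .inl hi))
  | in2 b x k S _ _ _ _ _ ih =>
    exact fun κ hi => (ih hX.pastInp _ (mt .inr hi)).pastInp b x k S
      (disjoint_keys_gamma (mt .inl hi))
  | parL _ _ _ _ _ _ ih =>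
    exact fun κ hi => (ih hX.left _ (mt .inl hi)).parL hX (disjoint_keys_gamma (mt .inr hi))
  | parR _ _ _ _ _ _ ih =>
    exact fun κ hi => (ih hX.right _ (mt .inr hi)).parR hX (disjoint_keys_gamma (mt .inl hi))
  | res a δ X _ μ _ ha ih =>
    exact fun κ hi => (ih hX.res κ (RProc.keys_toC_res .. ▸ hi)).res δ (by rwa [atoms_gamma])
  | comL _ _ _ _ _ _ _ _ _ _ _ _ _ _ _ _ ihX ihY =>
    exact fun κ hi => (ihX hX.left _ (mt .inl hi)).comL (ihY hX.right _ (mt .inr hi))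
  | comR _ _ _ _ _ _ _ _ _ _ _ _ _ _ _ _ ihX ihY =>
    exact fun κ hi => (ihX hX.right _ (mt .inr hi)).comR (ihY hX.left _ (mt .inl hi))
  | causeRef a δ X X' i S S' j π _ _ hδ _ ih =>
    exact fun κ hi =>
      ((ih hX.res κ (RProc.keys_toC_res .. ▸ hi)).updateCause i S S').res_of_not_empty hδ hδ
  | closeL _ _ _ _ i _ _ _ _ _ _ _ _ hs _ _ _ ihX ihY =>
    exact fun κ hi => ((ihX hX.left _ (mt .inl hi)).sharp (hs.memOk hX.left.memOk) i).closeL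
      (ihY hX.right _ (mt .inr hi)) hX
  | closeR _ _ _ _ i _ _ _ _ _ _ _ _ hs _ _ _ ihX ihY =>
    exact fun κ hi => ((ihX hX.right _ (mt .inr hi)).sharp (hs.memOk hX.right.memOk) i).closeR
      (ihY hX.left _ (mt .inl hi)) hX
  | _ a δ X X' i S S' j b π _ hπ hb _ ih =>
    exact fun κ hi => ((ih hX.res κ (RProc.keys_toC_res .. ▸ hi)).updateCause i S S').extrude_gamma
      hπ hb hX.notMem_binders

/-! ### Coherence along forward transitions -/

theorem FStep.exists_bstep {X X' : RProc} {μ : FLabel} (h : FStep X μ X') (hX : X.Coherent) :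
    ∃ K κ, BStep (X.toC fun _ => ∅) K (gamma μ) (X'.toC κ) := by
  have hfresh : μ.key ∉ (X.toC fun _ => ∅).keys := fun hk =>
    (RProc.mem_keys_toC.1 hk).elim fun _ hv => hv.2
  obtain ⟨K, _, hs, κ, -, rfl⟩ := h.mirrors hX _ hfresh
  exact ⟨K, κ, hs⟩

theorem FStep.boundDistinct {X X' : RProc} {μ : FLabel} (h : FStep X μ X') (hX : X.Coherent) :
    X'.erase.BoundDistinct := by
  obtain ⟨K, κ, hs⟩ := h.exists_bstep hX
  rw [← RProc.erase_toC X' κ]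
  exact hs.boundDistinct (RProc.erase_toC X _ ▸ hX.boundDistinct)

theorem FStep.binders_subset {X X' : RProc} {μ : FLabel} (h : FStep X μ X') (hX : X.Coherent) :
    X'.erase.binders ⊆ X.erase.binders := by
  obtain ⟨K, κ, hs⟩ := h.exists_bstep hX
  simpa only [RProc.erase_toC] using hs.binders_subset

theorem FStep.mem_free_of_bout {X X' : RProc} {i : Key} {S : Set SKey} {j : SKey} {b : Atom}
    {a : Name} {δ : Mem} (h : FStep X ⟨i, S, j, .bout b a δ⟩ X') (hX : X.Coherent)
    (hδ : ¬ δ.Empty) : .name a ∈ X.erase.free := by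
  obtain ⟨K, κ, hs⟩ := h.exists_bstep hX
  rw [gamma_bout_of_not_empty hδ] at hs
  simpa [BLabel.bound, RProc.free_toC] using hs.label_free (Or.inr rfl)

theorem FStep.notMem_binders_of_bout {X X' Y Y' : RProc} {μ : FLabel} {i : Key} {S : Set SKey}
    {j : SKey} {b : Atom} {a : Name} {δ : Mem} (hX : FStep X ⟨i, S, j, .bout b a δ⟩ X')
    (hY : FStep Y μ Y') (hcX : X.Coherent) (hcY : Y.Coherent)
    (hdisj : ∀ c ∈ Y.erase.binders, c ∉ X.erase.free) (hδ : ¬ δ.Empty) :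
    .name a ∉ X'.erase.binders ∧ .name a ∉ Y'.erase.binders := by
  have ha := hX.mem_free_of_bout hcX hδ
  exact ⟨fun hb => hcX.boundDistinct.2 _ (hX.binders_subset hcX hb) ha,
    fun hb => hdisj _ (hY.binders_subset hcY hb) ha⟩

theorem FStep.noShadowing {X X' : RProc} {μ : FLabel} (h : FStep X μ X') (hX : X.Coherent) :
    X'.NoShadowing := by
  induction h with
  | out1 | in1 => exact RProc.noShadowing_ofProc _
  | out2 _ _ _ _ _ _ _ _ _ ih => exact ih hX.pastOut
  | in2 _ _ _ _ _ _ _ _ _ ih => exact ih hX.pastInp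
  | parL _ _ _ _ _ _ ih => exact ⟨ih hX.left, hX.noShadowing.2⟩
  | parR _ _ _ _ _ _ ih => exact ⟨hX.noShadowing.1, ih hX.right⟩
  | res _ _ _ _ _ h _ ih =>
    exact ⟨fun _ hb => hX.notMem_binders (h.binders_subset hX.res hb), ih hX.res⟩
  | comL _ _ _ _ _ _ _ _ _ _ _ _ _ _ _ _ ihX ihY =>
    exact ⟨ihX hX.left, (ihY hX.right).subst ..⟩
  | comR _ _ _ _ _ _ _ _ _ _ _ _ _ _ _ _ ihX ihY =>
    exact ⟨(ihY hX.left).subst .., ihX hX.right⟩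
  | causeRef _ _ _ _ _ _ _ _ _ h _ _ _ ih =>
    refine ⟨fun _ hb => hX.notMem_binders (h.binders_subset hX.res ?_), (ih hX.res).updateCause ..⟩
    rwa [RProc.erase_updateCause] at hb
  | closeL _ _ _ _ _ _ _ _ _ _ _ _ _ h₁ h₂ _ _ ihX ihY =>
    have hok := h₁.memOk hX.left.memOk
    refine ⟨fun hδ => ?_, (ihX hX.left).sharp hok _, (ihY hX.right).subst ..⟩
    simpa [RProc.erase, Proc.binders, hok.erase_sharp, RProc.binders_erase_subst] using
      h₁.notMem_binders_of_bout h₂ hX.left hX.right hX.boundDistinct.of_par.2.2.2 hδ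
  | closeR _ _ _ _ _ _ _ _ _ _ _ _ _ h₁ h₂ _ _ ihX ihY =>
    have hok := h₁.memOk hX.right.memOk
    refine ⟨fun hδ => ?_, (ihY hX.left).subst .., (ihX hX.right).sharp hok _⟩
    simpa [RProc.erase, Proc.binders, hok.erase_sharp, RProc.binders_erase_subst] using
      (h₁.notMem_binders_of_bout h₂ hX.right hX.left hX.boundDistinct.of_par.2.2.1 hδ).symm
  | _ _ _ _ _ _ _ _ _ _ _ h _ _ _ ih =>
    refine ⟨fun _ hb => hX.notMem_binders (h.binders_subset hX.res ?_), (ih hX.res).updateCause ..⟩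
    rwa [RProc.erase_updateCause] at hb

theorem FStep.coherent {X X' : RProc} {μ : FLabel} (h : FStep X μ X') (hX : X.Coherent) :
    X'.Coherent :=
  ⟨h.memOk hX.memOk, h.noShadowing hX, h.boundDistinct hX⟩

/-! ### From causal to reversible transitions -/

/-- The label `ζ` with its key, if it has one, replaced by `i`. -/
def BLabel.rekey (i : Key) : BLabel → BLabel
  | vis _ π => vis i π
  | tau => tau

theorem BLabel.atoms_rekey (i : Key) (ζ : BLabel) : (ζ.rekey i).atoms = ζ.atoms := by
  rcases ζ with ⟨k, π⟩ | _
  · cases π <;> rfl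
  · rfl

theorem eq_out_or_bout_of_gamma_eq {i k : Key} {L : Set SKey} {j : SKey} {π : FAct} {b a : Atom}
    (h : gamma ⟨i, L, j, π⟩ = .vis k (.out b a)) :
    π = .out b a ∨ ∃ c δ, a = .name c ∧ ¬ δ.Empty ∧ π = .bout b c δ := by
  rcases π with _ | _ | ⟨b', c, δ⟩ | _
  · cases h
    exact .inl rfl
  · cases h
  · by_cases hδ : δ.Empty
    · cases (gamma_bout_of_empty hδ).symm.trans h
    · cases (gamma_bout_of_not_empty hδ).symm.trans h
      exact .inr ⟨c, δ, rfl, hδ, rfl⟩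
  · cases h

theorem eq_inp_of_gamma_eq {i k : Key} {L : Set SKey} {j : SKey} {π : FAct} {b : Atom} {x : Var}
    (h : gamma ⟨i, L, j, π⟩ = .vis k (.inp b x)) : π = .inp b x := by
  rcases π with _ | _ | ⟨b', c, δ⟩ | _
  · cases h
  · cases h
    rfl
  · by_cases hδ : δ.Empty
    · cases (gamma_bout_of_empty hδ).symm.trans h
    · cases (gamma_bout_of_not_empty hδ).symm.trans h
  · cases h

theorem eq_bout_of_gamma_eq {i k : Key} {L : Set SKey} {j : SKey} {π : FAct} {b : Atom} {a : Name}
    (h : gamma ⟨i, L, j, π⟩ = .vis k (.bout b a)) : ∃ δ, δ.Empty ∧ π = .bout b a δ := by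
  rcases π with _ | _ | ⟨b', c, δ⟩ | _
  · cases h
  · cases h
  · by_cases hδ : δ.Empty
    · cases (gamma_bout_of_empty hδ).symm.trans h
      exact ⟨δ, hδ, rfl⟩
    · cases (gamma_bout_of_not_empty hδ).symm.trans h
  · cases h

/-- The reversible process `X` has an action with key `i` that can be read as the causal action
with label `ζ` and cause set `K` that leads to `A`. The contextual cause set of the action contains
`*`, so that the action can synchronise with any other one. -/
def Lifts (X : RProc) (κ : Causes) (i : Key) (ζ : BLabel) (K : Set Key) (A : CProc) : Prop :=
  ∃ X' S j π, FStep X ⟨i, S, j, π⟩ X' ∧ none ∈ S ∧ gamma ⟨i, S, j, π⟩ = ζ.rekey i ∧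
    ReadsAs X X' κ i ζ K A

namespace Lifts

variable {X Y : RProc} {κ : Causes} {i k : Key} {ζ : BLabel} {K L : Set Key} {A B : CProc}

theorem pastOut {b a : DAtom} {j : Key} {S : Set SKey} (h : Lifts X (κ.below false) i ζ K A)
    (hi : i ∉ (RProc.pastOut b a j S X).keys) :
    Lifts (.pastOut b a j S X) κ i ζ (κ [] ∪ K) (.cause (κ []) A) := by
  obtain ⟨X', T, l, π, hs, hT, hγ, hr⟩ := h
  exact ⟨_, T, l, π, .out2 b a j S X X' _ hs hi, hT, hγ, hr.pastOut b a j S⟩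

theorem pastInp {b : DAtom} {x : Var} {j : Key} {S : Set SKey}
    (h : Lifts X (κ.below false) i ζ K A) (hi : i ∉ (RProc.pastInp b x j S X).keys) :
    Lifts (.pastInp b x j S X) κ i ζ (κ [] ∪ K) (.cause (κ []) A) := by
  obtain ⟨X', T, l, π, hs, hT, hγ, hr⟩ := h
  exact ⟨_, T, l, π, .in2 b x j S X X' _ hs hi, hT, hγ, hr.pastInp b x j S⟩

theorem parL (h : Lifts X (κ.below false) i ζ K A) (hi : i ∉ Y.keys) :
    Lifts (.par X Y) κ i ζ K (.par A (Y.toC (κ.below true))) := by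
  obtain ⟨X', T, l, π, hs, hT, hγ, hr⟩ := h
  exact ⟨_, T, l, π, .parL X X' Y _ hs hi, hT, hγ, hr.parL Y⟩

theorem parR (h : Lifts X (κ.below true) i ζ K A) (hi : i ∉ Y.keys) :
    Lifts (.par Y X) κ i ζ K (.par (Y.toC (κ.below false)) A) := by
  obtain ⟨X', T, l, π, hs, hT, hγ, hr⟩ := h
  exact ⟨_, T, l, π, .parR Y X X' _ hs hi, hT, hγ, hr.parR Y⟩

theorem res {a : Name} {δ : Mem} (h : Lifts X κ i ζ K A) (hδ : δ.Empty) (ha : .name a ∉ ζ.atoms) :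
    Lifts (.res a δ X) κ i ζ K (.res a A) := by
  obtain ⟨X', T, l, π, hs, hT, hγ, hr⟩ := h
  refine ⟨_, T, l, π, .res a δ X X' _ hs ?_, hT, hγ, hr.res hδ⟩
  rwa [← BLabel.atoms_rekey i, ← hγ, atoms_gamma] at ha

theorem extrude {a : Name} {b : Atom} {δ : Mem} (h : Lifts X κ i (.vis k (.out b (.name a))) K A)
    (hδ : δ.Empty) (hb : b ≠ .name a) : Lifts (.res a δ X) κ i (.vis k (.bout b a)) K A := by
  obtain ⟨X', T, l, π, hs, hT, hγ, hr⟩ := h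
  refine ⟨_, T ∪ {δ.idx}, l, _, .open a δ X X' i T _ l b π hs ?_ (fun _ => hb) rfl, .inl hT,
    gamma_bout_of_empty hδ, (hr.updateCause i T _).res_of_not_empty δ (δ.not_empty_add i)⟩
  rcases eq_out_or_bout_of_gamma_eq hγ with hπ | ⟨c, δ', hc, -, hπ⟩
  · exact .inl hπ
  · cases hc
    exact .inr ⟨δ', hπ⟩

theorem res_of_not_empty {a : Name} {δ : Mem} (h : Lifts X κ i ζ K A)
    (hX : (RProc.res a δ X).Coherent) (hδ : ¬ δ.Empty) : Lifts (.res a δ X) κ i ζ K A := by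
  obtain ⟨X', T, l, π, hs, hT, hγ, hr⟩ := h
  by_cases hobj : ∃ b, π = .out b (.name a) ∨ ∃ δ', π = .bout b a δ'
  · obtain ⟨b, hπ⟩ := hobj
    refine ⟨_, T ∪ {δ.idx}, l, _, .open a δ X X' i T _ l b π hs hπ (absurd · hδ) rfl, .inl hT, ?_,
      (hr.updateCause i T _).res_of_not_empty δ (δ.not_empty_add i)⟩
    obtain ⟨K, κ', h⟩ := hs.exists_bstep hX.res
    rw [gamma_bout_of_not_empty hδ, ← hγ, gamma_of_output hπ fun ha => hX.notMem_binders ?_]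
    simpa only [RProc.erase_toC] using h.bound_subset _ ha
  · by_cases hsub : .name a ∈ π.sub
    · exact ⟨_, T ∪ {δ.idx}, l, π, .causeRef a δ X X' i T _ l π hs hsub hδ rfl, .inl hT, hγ,
        (hr.updateCause i T _).res_of_not_empty δ hδ⟩
    · refine ⟨_, T, l, π, .res a δ X X' _ hs ?_, hT, hγ, hr.res_of_not_empty δ hδ⟩
      cases π <;> simp_all [FAct.sub, FAct.atoms, eq_comm]

theorem comL {b a : Atom} {x : Var} (hX : Lifts X (κ.below false) i (.vis k (.out b a)) K A)
    (hY : Lifts Y (κ.below true) i (.vis k (.inp b x)) L B) (hXc : X.Coherent)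
    (hkX : k ∉ (X.toC (κ.below false)).keys) (hkY : k ∉ (Y.toC (κ.below true)).keys) :
    Lifts (.par X Y) κ i .tau (K ∪ L)
      (.par (A.replaceCause k L) ((B.subst x a).replaceCause k K)) := by
  obtain ⟨X', S, j, π, hs, hS, hγ, hr⟩ := hX
  obtain ⟨Y', T, l, ρ, ht, hT, hγ', hq⟩ := hY
  cases eq_inp_of_gamma_eq hγ'
  have hcom := hr.synchronise (hq.subst x a i) hkX hkY
  rcases eq_out_or_bout_of_gamma_eq hγ with rfl | ⟨c, δ, rfl, hδ, rfl⟩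
  · exact ⟨_, _, _, _, .comL X X' Y Y' i S T j l b a x hs ht (.inl hS) (.inl hT), rfl, rfl, hcom⟩
  · refine ⟨_, _, _, _, .closeL X X' Y Y' i S T j l b c δ x hs ht (.inl hS) (.inl hT), rfl, rfl,
      ReadsAs.res_of_not_empty (X := X.par Y) ?_ δ hδ⟩
    exact (hr.sharp (hs.memOk hXc.memOk) i).synchronise (hq.subst x (.name c) i) hkX hkY

theorem comR {b a : Atom} {x : Var} (hX : Lifts X (κ.below true) i (.vis k (.out b a)) K A)
    (hY : Lifts Y (κ.below false) i (.vis k (.inp b x)) L B) (hXc : X.Coherent)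
    (hkX : k ∉ (X.toC (κ.below true)).keys) (hkY : k ∉ (Y.toC (κ.below false)).keys) :
    Lifts (.par Y X) κ i .tau (K ∪ L)
      (.par ((B.subst x a).replaceCause k K) (A.replaceCause k L)) := by
  obtain ⟨X', S, j, π, hs, hS, hγ, hr⟩ := hX
  obtain ⟨Y', T, l, ρ, ht, hT, hγ', hq⟩ := hY
  cases eq_inp_of_gamma_eq hγ'
  rw [Set.union_comm]
  have hcom := (hq.subst x a i).synchronise hr hkY hkX
  rcases eq_out_or_bout_of_gamma_eq hγ with rfl | ⟨c, δ, rfl, hδ, rfl⟩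
  · exact ⟨_, _, _, _, .comR X X' Y Y' i S T j l b a x hs ht (.inl hS) (.inl hT), rfl, rfl, hcom⟩
  · refine ⟨_, _, _, _, .closeR X X' Y Y' i S T j l b c δ x hs ht (.inl hS) (.inl hT), rfl, rfl,
      ReadsAs.res_of_not_empty (X := Y.par X) ?_ δ hδ⟩
    exact (hq.subst x (.name c) i).synchronise (hr.sharp (hs.memOk hXc.memOk) i) hkY hkX

theorem closeL {b : Atom} {a : Name} {x : Var}
    (hX : Lifts X (κ.below false) i (.vis k (.bout b a)) K A)
    (hY : Lifts Y (κ.below true) i (.vis k (.inp b x)) L B) (hXc : X.Coherent)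
    (hkX : k ∉ (X.toC (κ.below false)).keys) (hkY : k ∉ (Y.toC (κ.below true)).keys) :
    Lifts (.par X Y) κ i .tau (K ∪ L)
      (.res a (.par (A.replaceCause k L) ((B.subst x (.name a)).replaceCause k K))) := by
  obtain ⟨X', S, j, π, hs, hS, hγ, hr⟩ := hX
  obtain ⟨Y', T, l, ρ, ht, hT, hγ', hq⟩ := hY
  cases eq_inp_of_gamma_eq hγ'
  obtain ⟨δ, hδ, rfl⟩ := eq_bout_of_gamma_eq hγ
  refine ⟨_, _, _, _, .closeL X X' Y Y' i S T j l b a δ x hs ht (.inl hS) (.inl hT), rfl, rfl,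
    ReadsAs.res (X := X.par Y) ?_ hδ⟩
  exact (hr.sharp (hs.memOk hXc.memOk) i).synchronise (hq.subst x (.name a) i) hkX hkY

theorem closeR {b : Atom} {a : Name} {x : Var}
    (hX : Lifts X (κ.below true) i (.vis k (.bout b a)) K A)
    (hY : Lifts Y (κ.below false) i (.vis k (.inp b x)) L B) (hXc : X.Coherent)
    (hkX : k ∉ (X.toC (κ.below true)).keys) (hkY : k ∉ (Y.toC (κ.below false)).keys) :
    Lifts (.par Y X) κ i .tau (K ∪ L)
      (.res a (.par ((B.subst x (.name a)).replaceCause k K) (A.replaceCause k L))) := by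
  obtain ⟨X', S, j, π, hs, hS, hγ, hr⟩ := hX
  obtain ⟨Y', T, l, ρ, ht, hT, hγ', hq⟩ := hY
  cases eq_inp_of_gamma_eq hγ'
  obtain ⟨δ, hδ, rfl⟩ := eq_bout_of_gamma_eq hγ
  rw [Set.union_comm]
  refine ⟨_, _, _, _, .closeR X X' Y Y' i S T j l b a δ x hs ht (.inl hS) (.inl hT), rfl, rfl,
    ReadsAs.res (X := Y.par X) ?_ hδ⟩
  exact (hq.subst x (.name a) i).synchronise (hr.sharp (hs.memOk hXc.memOk) i) hkY hkX

end Lifts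

theorem RProc.lifts {i : Key} {X : RProc} (hX : X.Coherent) (hi : i ∉ X.keys) {κ : Causes}
    {K : Set Key} {ζ : BLabel} {A : CProc} (h : BStep (X.toC κ) K ζ A) : Lifts X κ i ζ K A := by
  induction X generalizing κ K ζ A with
  | nil => cases h
  | out b a P =>
    rcases h with _ | _
    exact ⟨_, {none}, _, _, .out1 b a P i _, rfl, rfl, .out b a P κ i _ _ _⟩
  | inp b x P =>
    rcases h with _ | _
    exact ⟨_, {none}, _, _, .in1 b x P i _, rfl, rfl, .inp b x P κ i _ _ _⟩
  | pastOut b a j S X ih =>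
    rcases h with _ | _ | ⟨_, _, _, _, _, h, -⟩
    exact (ih hX.pastOut (mt .inr hi) h).pastOut hi
  | pastInp b x j S X ih =>
    rcases h with _ | _ | ⟨_, _, _, _, _, h, -⟩
    exact (ih hX.pastInp (mt .inr hi) h).pastInp hi
  | par X Y ihX ihY =>
    have ihX := @ihX hX.left (mt .inl hi)
    have ihY := @ihY hX.right (mt .inr hi)
    cases h with
    | parL _ _ _ _ _ h => exact (ihX h).parL (mt .inr hi)
    | parR _ _ _ _ _ h => exact (ihY h).parR (mt .inl hi)
    | comL _ _ _ _ _ _ _ _ _ _ h₁ h₂ =>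
      exact (ihX h₁).comL (ihY h₂) hX.left h₁.key_notMem h₂.key_notMem
    | comR _ _ _ _ _ _ _ _ _ _ h₁ h₂ =>
      exact (ihY h₁).comR (ihX h₂) hX.right h₁.key_notMem h₂.key_notMem
    | closeL _ _ _ _ _ _ _ _ _ _ h₁ h₂ =>
      exact (ihX h₁).closeL (ihY h₂) hX.left h₁.key_notMem h₂.key_notMem
    | closeR _ _ _ _ _ _ _ _ _ _ h₁ h₂ =>
      exact (ihY h₁).closeR (ihX h₂) hX.right h₁.key_notMem h₂.key_notMem
  | res a δ X ih =>
    by_cases hδ : δ.Empty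
    · rw [RProc.toC_res_of_empty hδ] at h
      cases h
      case res ha h => exact (ih hX.res hi h).res hδ ha
      · next hb h => exact (ih hX.res hi h).extrude hδ hb
    · rw [RProc.toC_res_of_not_empty hδ] at h
      exact (ih hX.res hi h).res_of_not_empty hX hδ

/-! ### Causes in the graph of a history -/

/-- The edges of the graph of a history with vertices `V`. -/
def histEdge (V : Set Vertex) (v w : Vertex) : Prop :=
  v ∈ V ∧ w ∈ V ∧ v ≠ w ∧ (v.1 <+: w.1 ∨ v.2 = w.2)

/-- `v` is the only vertex in `V` with its key: it is not merged with another vertex when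
bidirectional edges are contracted. -/
def UniqueKey (V : Set Vertex) (v : Vertex) : Prop := ∀ w ∈ V, w.2 = v.2 → w = v

/-- The unique keys in the past of `v`. -/
def pastKeys (V : Set Vertex) (v : Vertex) : Set Key :=
  {k | ∃ u ∈ V, u.2 = k ∧ UniqueKey V u ∧ Relation.ReflTransGen (histEdge V) u v}

/-- The cause sets `κ` describe the history `V`: vertices are determined by their addresses, and
the causes at and above a vertex are the unique keys in its past. -/
structure IsHistory (V : Set Vertex) (κ : Causes) : Prop where
  inj : Set.InjOn Prod.fst V
  causes : ∀ v ∈ V, causesAt V κ v.1 = pastKeys V v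

theorem isHistory_empty (κ : Causes) : IsHistory ∅ κ :=
  ⟨Set.injOn_empty _, by simp⟩

theorem IsHistory.exists_key {V : Set Vertex} {κ : Causes} (h : IsHistory V κ) {u : Vertex}
    (hu : u ∈ V) {m : Key} (hm : m ∈ κ u.1) : ∃ w ∈ V, w.2 = m := by
  have hcause : m ∈ causesAt V κ u.1 := ⟨u, hu, List.prefix_rfl, hm⟩
  rw [h.causes u hu] at hcause
  obtain ⟨w, hw, hk, -⟩ := hcause
  exact ⟨w, hw, hk⟩

namespace HistoryExt

variable {V V' : Set Vertex} {κ κ' : Causes} {i m : Key} {D : Set (List Bool)} {d : List Bool}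
  {K E : Set Key} {u v : Vertex}

open Relation

theorem subset (h : HistoryExt V V' κ κ' i D K E) : V ⊆ V' := fun v hv => (h.mem_iff v).2 (.inl hv)

theorem mem_new (h : HistoryExt V V' κ κ' i D K E) (hd : d ∈ D) : (d, i) ∈ V' :=
  (h.mem_iff _).2 (.inr ⟨hd, rfl⟩)

theorem reaches_mono (h : HistoryExt V V' κ κ' i D K E) (hr : ReflTransGen (histEdge V) u v) :
    ReflTransGen (histEdge V') u v :=
  ReflTransGen.mono (fun _ _ he => ⟨h.subset he.1, h.subset he.2.1, he.2.2⟩) _ _ hr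

theorem reaches_old (h : HistoryExt V V' κ κ' i D K E) (hi : ∀ u ∈ V, u.2 ≠ i) (hv : v ∈ V)
    (hr : ReflTransGen (histEdge V') u v) : u ∈ V ∧ ReflTransGen (histEdge V) u v := by
  induction hr using ReflTransGen.head_induction_on with
  | refl => exact ⟨hv, .refl⟩
  | head he _ ih =>
    obtain ⟨hc, hr⟩ := ih
    obtain ⟨hu, -, hne, hor⟩ := he
    rcases (h.mem_iff _).1 hu with hu | ⟨hd, hk⟩
    · exact ⟨hu, .head ⟨hu, hc, hne, hor⟩ hr⟩
    · rcases hor with hp | hp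
      · exact absurd hp (h.leaf _ hd _ hc)
      · exact absurd (hp.symm.trans hk) (hi _ hc)

theorem reaches_new (h : HistoryExt V V' κ κ' i D K E) (hi : ∀ u ∈ V, u.2 ≠ i) (hd : d ∈ D)
    (hr : ReflTransGen (histEdge V') u (d, i)) : (u.1 ∈ D ∧ u.2 = i) ∨
      ∃ d ∈ D, ∃ v ∈ V, v.1 <+: d ∧ u ∈ V ∧ ReflTransGen (histEdge V) u v := by
  induction hr using ReflTransGen.head_induction_on with
  | refl => exact .inl ⟨hd, rfl⟩
  | head he _ ih =>
    rcases ih with ⟨hd, hk⟩ | ⟨d, hd, v, hv, hp, -, hr⟩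
    · obtain ⟨hu, -, -, hor⟩ := he
      rcases (h.mem_iff _).1 hu with hu | hu
      · rcases hor with hp | hp
        · exact .inr ⟨_, hd, _, hu, hp, hu, .refl⟩
        · exact absurd (hp.trans hk) (hi _ hu)
      · exact .inl hu
    · exact .inr ⟨d, hd, v, hv, hp, h.reaches_old hi hv (.head he (h.reaches_mono hr))⟩

theorem reaches_of_isPrefix (h : HistoryExt V V' κ κ' i D K E) (hi : ∀ u ∈ V, u.2 ≠ i)
    {d' : List Bool} (hd' : d' ∈ D) (hd : d ∈ D) (hv : v ∈ V) (hp : v.1 <+: d)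
    (hr : ReflTransGen (histEdge V) u v) : ReflTransGen (histEdge V') u (d', i) := by
  have hud : ReflTransGen (histEdge V') u (d, i) := (h.reaches_mono hr).tail
    ⟨h.subset hv, h.mem_new hd, fun e => hi v hv (congrArg Prod.snd e), .inl hp⟩
  by_cases hdd : (d, i) = (d', i)
  · exact hdd ▸ hud
  · exact hud.tail ⟨h.mem_new hd, h.mem_new hd', hdd, .inr rfl⟩

theorem uniqueKey_iff (h : HistoryExt V V' κ κ' i D K E) (hi : ∀ u ∈ V, u.2 ≠ i) (hu : u ∈ V) :
    UniqueKey V' u ↔ UniqueKey V u := by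
  refine ⟨fun hq w hw => hq w (h.subset hw), fun hq w hw he => ?_⟩
  rcases (h.mem_iff w).1 hw with hw | ⟨-, hk⟩
  · exact hq w hw he
  · exact absurd (he.symm.trans hk) (hi u hu)

theorem uniqueKey_new_iff (h : HistoryExt V V' κ κ' i D K E) (hi : ∀ u ∈ V, u.2 ≠ i) (hd : d ∈ D) :
    UniqueKey V' (d, i) ↔ D.Subsingleton := by
  constructor
  · intro hq d₁ h₁ d₂ h₂
    have hu₁ := hq _ (h.mem_new h₁) rfl
    have hu₂ := hq _ (h.mem_new h₂) rfl
    exact congrArg Prod.fst (hu₁.trans hu₂.symm)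
  · intro hD w hw he
    rcases (h.mem_iff w).1 hw with hw | ⟨hwD, -⟩
    · exact absurd he (hi w hw)
    · exact Prod.ext (hD hwD hd) he

theorem pastKeys_old (h : HistoryExt V V' κ κ' i D K E) (hi : ∀ u ∈ V, u.2 ≠ i) (hv : v ∈ V) :
    pastKeys V' v = pastKeys V v := by
  ext k
  constructor
  · rintro ⟨u, -, hk, hq, hr⟩
    obtain ⟨hu, hr⟩ := h.reaches_old hi hv hr
    exact ⟨u, hu, hk, (h.uniqueKey_iff hi hu).1 hq, hr⟩
  · rintro ⟨u, hu, hk, hq, hr⟩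
    exact ⟨u, h.subset hu, hk, (h.uniqueKey_iff hi hu).2 hq, h.reaches_mono hr⟩

theorem mem_causes_iff (h : HistoryExt V V' κ κ' i D K E) (hh : IsHistory V κ) :
    m ∈ K ↔ ∃ d ∈ D, ∃ v ∈ V, v.1 <+: d ∧ m ∈ pastKeys V v := by
  simp only [h.causes, Set.mem_iUnion, exists_prop]
  refine exists_congr fun d => and_congr_right fun _ => ⟨?_, ?_⟩
  · rintro ⟨v, hv, hp, hm⟩
    exact ⟨v, hv, hp, hh.causes v hv ▸ ⟨v, hv, List.prefix_rfl, hm⟩⟩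
  · rintro ⟨v, hv, hp, hm⟩
    obtain ⟨w, hw, hwv, hm⟩ := (hh.causes v hv).symm ▸ hm
    exact ⟨w, hw, hwv.trans hp, hm⟩

theorem pastKeys_new (h : HistoryExt V V' κ κ' i D K E) (hh : IsHistory V κ)
    (hi : ∀ u ∈ V, u.2 ≠ i) (hE : ∀ m, m ∈ E ↔ m = i ∧ D.Subsingleton) (hd : d ∈ D) :
    pastKeys V' (d, i) = K ∪ E := by
  ext m
  constructor
  · rintro ⟨u, -, rfl, hq, hr⟩
    rcases h.reaches_new hi hd hr with ⟨huD, hk⟩ | ⟨d', hd', v, hv, hp, hu, hr⟩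
    · obtain ⟨e, l⟩ := u
      obtain rfl : l = i := hk
      exact .inr ((hE _).2 ⟨rfl, (h.uniqueKey_new_iff hi huD).1 hq⟩)
    · exact .inl ((h.mem_causes_iff hh).2
        ⟨d', hd', v, hv, hp, u, hu, rfl, (h.uniqueKey_iff hi hu).1 hq, hr⟩)
  · rintro (hm | hm)
    · obtain ⟨d', hd', v, hv, hp, u, hu, hk, hq, hr⟩ := (h.mem_causes_iff hh).1 hm
      exact ⟨u, h.subset hu, hk, (h.uniqueKey_iff hi hu).2 hq,
        h.reaches_of_isPrefix hi hd hd' hv hp hr⟩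
    · obtain ⟨rfl, hD⟩ := (hE m).1 hm
      exact ⟨_, h.mem_new hd, rfl, (h.uniqueKey_new_iff hi hd).2 hD, .refl⟩

theorem causesAt_old (h : HistoryExt V V' κ κ' i D K E) (hv : v ∈ V) :
    causesAt V' κ' v.1 = causesAt V κ v.1 := by
  ext m
  constructor
  · rintro ⟨u, hu, hp, hm⟩
    rcases (h.mem_iff u).1 hu with hu | ⟨hd, -⟩
    · exact ⟨u, hu, hp, h.agree u hu ▸ hm⟩
    · exact absurd hp (h.leaf _ hd v hv)
  · rintro ⟨u, hu, hp, hm⟩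
    exact ⟨u, h.subset hu, hp, (h.agree u hu).symm ▸ hm⟩

theorem causesAt_new (h : HistoryExt V V' κ κ' i D K E) (hd : d ∈ D) :
    causesAt V' κ' d = K ∪ E := by
  ext m
  constructor
  · rintro ⟨u, hu, hp, hm⟩
    rcases (h.mem_iff u).1 hu with hu | ⟨hd', -⟩
    · exact h.new d hd ▸ .inl ⟨u, hu, hp, h.agree u hu ▸ hm⟩
    · exact h.new _ hd' ▸ .inr hm
  · rw [← h.new d hd]
    rintro (⟨u, hu, hp, hm⟩ | hm)
    · exact ⟨u, h.subset hu, hp, (h.agree u hu).symm ▸ hm⟩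
    · exact ⟨_, h.mem_new hd, List.prefix_rfl, hm⟩

theorem isHistory (h : HistoryExt V V' κ κ' i D K E) (hh : IsHistory V κ)
    (hi : ∀ u ∈ V, u.2 ≠ i) (hE : ∀ m, m ∈ E ↔ m = i ∧ D.Subsingleton) : IsHistory V' κ' where
  inj v hv w hw he := by
    rcases (h.mem_iff v).1 hv with hv | ⟨hd, hk⟩ <;> rcases (h.mem_iff w).1 hw with hw | ⟨hd', hk'⟩
    · exact hh.inj hv hw he
    · exact absurd (he ▸ List.prefix_rfl) (h.leaf _ hd' v hv)
    · exact absurd (he ▸ List.prefix_rfl) (h.leaf _ hd w hw)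
    · exact Prod.ext he (hk.trans hk'.symm)
  causes v hv := by
    rcases (h.mem_iff v).1 hv with hv | ⟨hd, rfl⟩
    · rw [h.pastKeys_old hi hv, h.causesAt_old hv, hh.causes v hv]
    · exact (h.causesAt_new hd).trans (h.pastKeys_new hh hi hE hd).symm

end HistoryExt

namespace RProc

theorem mem_verts_past {X : RProc} {i : Key} {v : Vertex} :
    v ∈ (X.histGraph.past i).verts ↔ v ∈ X.vertices ∧ X.histGraph.Reaches i v := by
  simp only [HistGraph.past, Multiset.mem_filter]
  rfl

theorem exists_bidir_past_iff {X : RProc} {i : Key} (hinj : Set.InjOn Prod.fst X.vertices)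
    {v : Vertex} (hv : v ∈ X.vertices) (hr : X.histGraph.Reaches i v) :
    (∃ w, (X.histGraph.past i).Bidir v w) ↔ ¬ UniqueKey X.vertices v := by
  constructor
  · rintro ⟨w, ⟨⟨-, hw, hne, h₁⟩, -⟩, ⟨⟨-, -, -, h₂⟩, -⟩⟩ hq
    rcases h₁ with h₁ | h₁
    · rcases h₂ with h₂ | h₂
      · exact hne (hinj hv hw (h₁.eq_of_length_le h₂.length_le))
      · exact hne (hq w hw h₂).symm
    · exact hne (hq w hw h₁.symm).symm
  · intro hq
    simp only [UniqueKey, not_forall, exists_prop] at hq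
    obtain ⟨w, hw, hk, hne⟩ := hq
    have hrw : X.histGraph.Reaches i w := by
      obtain ⟨n, hn, hni, hp⟩ := hr
      exact ⟨n, hn, hni, .head ⟨hw, hv, hne, .inr hk⟩ hp⟩
    exact ⟨w, ⟨⟨hv, hw, Ne.symm hne, .inr hk.symm⟩, hr, hrw⟩, ⟨hw, hv, hne, .inr hk⟩, hrw, hr⟩

theorem contract_past_eq_key_iff {X : RProc} {i : Key} (hinj : Set.InjOn Prod.fst X.vertices)
    {v : Vertex} (hv : v ∈ X.vertices) (hr : X.histGraph.Reaches i v) (k : Key) :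
    (X.histGraph.past i).contract v = .key k ↔ UniqueKey X.vertices v ∧ v.2 = k := by
  have hmerged := exists_bidir_past_iff hinj hv hr
  by_cases hq : UniqueKey X.vertices v
  · rw [HistGraph.contract, if_neg fun h => hmerged.1 h hq]
    simp [hq]
  · rw [HistGraph.contract, if_pos (hmerged.2 hq)]
    simp [hq]

theorem mem_rem_structCauses {X : RProc} {i : Key} (hinj : Set.InjOn Prod.fst X.vertices)
    {k : Key} : k ∈ X.Rem i (X.structCauses i) ↔
      k ≠ i ∧ ∃ n ∈ X.vertices, n.2 = i ∧ k ∈ pastKeys X.vertices n := by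
  constructor
  · rintro ⟨hk, v, hv, hc⟩
    obtain ⟨hv, hr⟩ := mem_verts_past.1 hv
    obtain ⟨hq, hvk⟩ := (contract_past_eq_key_iff hinj hv hr k).1 hc
    obtain ⟨n, hn, hni, hp⟩ := hr
    exact ⟨(Multiset.mem_filter.1 hk).2, n, hn, hni, v, hv, hvk, hq, hp⟩
  · rintro ⟨hk, n, hn, hni, v, hv, hvk, hq, hp⟩
    have hr : X.histGraph.Reaches i v := ⟨n, hn, hni, hp⟩
    have hv' := mem_verts_past.2 ⟨hv, hr⟩
    exact ⟨Multiset.mem_filter.2 ⟨Multiset.mem_map.2 ⟨v, hv', hvk⟩, hk⟩, v, hv',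
      (contract_past_eq_key_iff hinj hv hr k).2 ⟨hq, hvk⟩⟩

end RProc

theorem HistoryExt.rem_structCauses {V : Set Vertex} {X' : RProc} {κ κ' : Causes} {i : Key}
    {D : Set (List Bool)} {K E : Set Key} (h : HistoryExt V X'.vertices κ κ' i D K E)
    (hh : IsHistory V κ) (hi : ∀ u ∈ V, u.2 ≠ i) (hE : ∀ m, m ∈ E ↔ m = i ∧ D.Subsingleton)
    (hD : D.Nonempty) : X'.Rem i (X'.structCauses i) = K := by
  have hpast : ∀ n ∈ X'.vertices, n.2 = i → pastKeys X'.vertices n = K ∪ E := by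
    rintro ⟨d, _⟩ hn rfl
    exact h.pastKeys_new hh hi hE (((h.mem_iff _).1 hn).resolve_left fun hn => hi _ hn rfl).1
  ext k
  rw [RProc.mem_rem_structCauses (h.isHistory hh hi hE).inj]
  constructor
  · rintro ⟨hk, n, hn, hni, hm⟩
    rw [hpast n hn hni] at hm
    exact hm.resolve_right fun hm => hk ((hE k).1 hm).1
  · intro hk
    obtain ⟨d, hd⟩ := hD
    obtain ⟨-, -, -, -, -, u, hu, hki, -⟩ := (h.mem_causes_iff hh).1 hk
    exact ⟨hki ▸ hi u hu, _, h.mem_new hd, rfl, (hpast _ (h.mem_new hd) rfl).symm ▸ .inl hk⟩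

/-! ### Traces -/

/-- The invariant of corresponding traces: `X` is coherent, and `κ` describes its history. -/
structure RProc.Annotated (X : RProc) (κ : Causes) : Prop where
  coherent : X.Coherent
  isHistory : IsHistory X.vertices κ

theorem RProc.annotated_initial {P : Proc Atom} (hP : P.BoundDistinct) (κ : Causes) :
    (RProc.initial P).Annotated κ := by
  refine ⟨RProc.coherent_initial hP, ?_⟩
  rw [RProc.initial, RProc.vertices_ofProc]
  exact isHistory_empty κ

theorem RProc.keys_initial (P : Proc Atom) : (RProc.initial P).keys = ∅ := by
  simp only [Set.eq_empty_iff_forall_notMem, RProc.mem_keys, RProc.initial, RProc.vertices_ofProc,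
    Set.mem_empty_iff_false, false_and, exists_false, not_false_eq_true, implies_true]

theorem FStep.key_notMem {X X' : RProc} {μ : FLabel} (h : FStep X μ X') : μ.key ∉ X.keys := by
  induction h with
  | out1 | in1 => exact id
  | out2 | in2 => assumption
  | parL _ _ _ _ _ hk ih => exact fun h => h.elim ih hk
  | parR _ _ _ _ _ hk ih => exact fun h => h.elim hk ih
  | res _ _ _ _ _ _ _ ih => exact ih
  | causeRef _ _ _ _ _ _ _ _ _ _ _ _ _ ih => exact ih
  | comL _ _ _ _ _ _ _ _ _ _ _ _ _ _ _ _ ih₁ ih₂ => exact fun h => h.elim ih₁ ih₂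
  | comR _ _ _ _ _ _ _ _ _ _ _ _ _ _ _ _ ih₁ ih₂ => exact fun h => h.elim ih₂ ih₁
  | closeL _ _ _ _ _ _ _ _ _ _ _ _ _ _ _ _ _ ih₁ ih₂ => exact fun h => h.elim ih₁ ih₂
  | closeR _ _ _ _ _ _ _ _ _ _ _ _ _ _ _ _ _ ih₁ ih₂ => exact fun h => h.elim ih₂ ih₁
  | _ _ _ _ _ _ _ _ _ _ _ _ _ _ _ ih => exact ih

/-- Every key of `X` shows in its causal process or is at least `N`. If the visible actions of
a trace have keys below `N`, this leaves their keys free when silent actions take keys from `N`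
on. -/
def RProc.HiddenKeysFrom (N : ℕ) (X : RProc) (κ : Causes) : Prop :=
  ∀ k ∈ X.keys, k ∈ (X.toC κ).keys ∨ N ≤ k

theorem BLabel.Creates.mem_keys_gamma {μ : FLabel} {κ : Causes} {D : Set (List Bool)}
    (h : (gamma μ).Creates κ D) (m : Key) : m ∈ (gamma μ).keys ↔ m = μ.key ∧ D.Subsingleton := by
  have hμ := keys_gamma μ
  cases hγ : gamma μ with
  | vis k π =>
    rw [hγ] at h hμ
    obtain ⟨d, rfl, -⟩ := h
    obtain rfl : k = μ.key := Set.singleton_subset_singleton.1 hμ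
    exact (and_iff_left Set.subsingleton_singleton).symm
  | tau =>
    rw [hγ] at h
    exact iff_of_false id fun hD => Set.not_subsingleton_iff.2 h hD.2

namespace Grows

variable {X X' : RProc} {κ κ' : Causes} {μ : FLabel} {K : Set Key}

theorem annotated (h : Grows X.vertices X'.vertices κ κ' μ.key (gamma μ) K) (hs : FStep X μ X')
    (hX : X.Annotated κ) : X'.Annotated κ' := by
  obtain ⟨D, he, hD⟩ := h
  exact ⟨hs.coherent hX.coherent, he.isHistory hX.isHistory
    (fun u hu hk => hs.key_notMem (RProc.mem_keys.2 ⟨u, hu, hk⟩)) hD.mem_keys_gamma⟩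

theorem rem_structCauses (h : Grows X.vertices X'.vertices κ κ' μ.key (gamma μ) K)
    (hs : FStep X μ X') (hX : X.Annotated κ) : X'.Rem μ.key (X'.structCauses μ.key) = K := by
  obtain ⟨D, he, hD⟩ := h
  exact he.rem_structCauses hX.isHistory
    (fun u hu hk => hs.key_notMem (RProc.mem_keys.2 ⟨u, hu, hk⟩)) hD.mem_keys_gamma hD.nonempty

theorem hiddenKeysFrom {i : Key} {ζ : BLabel} {N : ℕ}
    (h : Grows X.vertices X'.vertices κ κ' i ζ K) (hX : X.HiddenKeysFrom N κ)
    (hi : i ∈ ζ.keys ∨ N ≤ i) : X'.HiddenKeysFrom N κ' := by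
  obtain ⟨D, he, hD⟩ := h
  intro k hk
  obtain ⟨v, hv, rfl⟩ := RProc.mem_keys.1 hk
  rcases (he.mem_iff v).1 hv with hv | ⟨-, rfl⟩
  · refine (hX _ (RProc.mem_keys.2 ⟨v, hv, rfl⟩)).imp_left fun hm => ?_
    obtain ⟨u, hu, hm⟩ := RProc.mem_keys_toC.1 hm
    exact RProc.mem_keys_toC.2 ⟨u, he.subset hu, (he.agree u hu).symm ▸ hm⟩
  · refine hi.imp_left fun hi => ?_
    cases ζ with
    | vis k π =>
      obtain ⟨d, rfl, hd⟩ := hD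
      exact RProc.mem_keys_toC.2 ⟨_, he.mem_new rfl, hd.symm ▸ hi⟩
    | tau => exact hi.elim

end Grows

theorem FStep.exists_bstep_annotated {X X' : RProc} {κ : Causes} {μ : FLabel} (h : FStep X μ X')
    (hX : X.Annotated κ) : ∃ κ' K, BStep (X.toC κ) K (gamma μ) (X'.toC κ') ∧ X'.Annotated κ' ∧
      X'.Rem μ.key (X'.structCauses μ.key) = K := by
  have hfresh : μ.key ∉ (X.toC κ).keys := fun hk => by
    obtain ⟨u, hu, hm⟩ := RProc.mem_keys_toC.1 hk
    exact h.key_notMem (RProc.mem_keys.2 (hX.isHistory.exists_key hu hm))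
  obtain ⟨K, _, hs, κ', hg, rfl⟩ := h.mirrors hX.coherent κ hfresh
  exact ⟨κ', K, hs, hg.annotated h hX, hg.rem_structCauses h hX⟩

theorem RProc.HiddenKeysFrom.exists_key {X : RProc} {κ : Causes} {K : Set Key} {ζ : BLabel}
    {A : CProc} {N : ℕ} (hX : X.HiddenKeysFrom N κ) (h : BStep (X.toC κ) K ζ A)
    (hζ : ∀ k ∈ ζ.keys, k < N) : ∃ i ∉ X.keys, ζ.rekey i = ζ ∧ (i ∈ ζ.keys ∨ N ≤ i) := by
  cases ζ with
  | vis k π =>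
    exact ⟨k, fun hk => (hX k hk).elim h.key_notMem (not_le_of_gt (hζ k rfl)), rfl, .inl rfl⟩
  | tau =>
    obtain ⟨i, hi⟩ := Infinite.exists_notMem_finset
      ((X.occs.map Prod.snd).toFinset ∪ Finset.range N)
    simp only [Finset.mem_union, List.mem_toFinset, List.mem_map, Finset.mem_range, not_or,
      not_lt] at hi
    exact ⟨i, fun hk => hi.1 (RProc.mem_keys.1 hk), rfl, .inr hi.2⟩

theorem BStep.exists_fstep_annotated {X : RProc} {κ : Causes} {K : Set Key} {ζ : BLabel}
    {A : CProc} {N : ℕ} (h : BStep (X.toC κ) K ζ A) (hX : X.Annotated κ)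
    (hN : X.HiddenKeysFrom N κ) (hζ : ∀ k ∈ ζ.keys, k < N) :
    ∃ X' κ' μ, X'.toC κ' = A ∧ FStep X μ X' ∧ gamma μ = ζ ∧ X'.Annotated κ' ∧
      X'.HiddenKeysFrom N κ' ∧ X'.Rem μ.key (X'.structCauses μ.key) = K := by
  obtain ⟨i, hi, hrekey, hshow⟩ := hN.exists_key h hζ
  obtain ⟨X', S, j, π, hs, -, hγ, κ', hg, rfl⟩ := RProc.lifts hX.coherent hi h
  obtain rfl := hγ.trans hrekey
  exact ⟨X', κ', _, rfl, hs, rfl, hg.annotated hs hX, hg.hiddenKeysFrom hN hshow,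
    hg.rem_structCauses hs hX⟩

theorem exists_fin_seq {α : Type*} {n : ℕ} (S : Fin (n + 1) → α → Prop) (R : Fin n → α → α → Prop)
    {a : α} (ha : S 0 a) (hstep : ∀ i x, S (Fin.castSucc i) x → ∃ y, S i.succ y ∧ R i x y) :
    ∃ f : Fin (n + 1) → α, f 0 = a ∧ (∀ i, S i (f i)) ∧ ∀ i, R i (f i.castSucc) (f i.succ) := by
  choose g hgS hgR using hstep
  let f : ∀ i : Fin (n + 1), {x // S i x} :=
    Fin.induction ⟨a, ha⟩ fun i x => ⟨g i x x.2, hgS i x x.2⟩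
  refine ⟨fun i => f i, rfl, fun i => (f i).2, fun i => ?_⟩
  have hsucc : f i.succ = ⟨g i (f i.castSucc) (f i.castSucc).2, hgS i _ _⟩ :=
    Fin.induction_succ _ _ _
  change R i (f i.castSucc) (f i.succ)
  exact hsucc ▸ hgR i _ _

theorem exists_key_bound {n : ℕ} (ζ : Fin n → BLabel) : ∃ N, ∀ i, ∀ k ∈ (ζ i).keys, k < N := by
  have hone : ∀ i, ∃ N, ∀ k ∈ (ζ i).keys, k < N := fun i => by
    cases ζ i with
    | vis k π => exact ⟨k + 1, by rintro _ rfl; exact Nat.lt_succ_self _⟩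
    | tau => exact ⟨0, fun _ h => h.elim⟩
  choose f hf using hone
  exact ⟨Finset.univ.sup f, fun i k hk =>
    (hf i k hk).trans_le (Finset.le_sup (Finset.mem_univ i))⟩

theorem exists_causal_trace {n : ℕ} {X : Fin (n + 1) → RProc} {μ : Fin n → FLabel} {κ₀ : Causes}
    (h₀ : (X 0).Annotated κ₀) (h : ∀ i : Fin n, FStep (X i.castSucc) (μ i) (X i.succ)) :
    ∃ (κ : Fin (n + 1) → Causes) (K : Fin n → Set Key), κ 0 = κ₀ ∧ ∀ i : Fin n,
      BStep ((X i.castSucc).toC (κ i.castSucc)) (K i) (gamma (μ i))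
        ((X i.succ).toC (κ i.succ)) ∧
      (X i.succ).Rem (μ i).key ((X i.succ).structCauses (μ i).key) = K i := by
  obtain ⟨κ, hκ, -, hR⟩ := exists_fin_seq (fun i κ => (X i).Annotated κ)
    (fun i κ κ' => ∃ K, BStep ((X i.castSucc).toC κ) K (gamma (μ i)) ((X i.succ).toC κ') ∧
      (X i.succ).Rem (μ i).key ((X i.succ).structCauses (μ i).key) = K) h₀ fun i κ hκ => by
    obtain ⟨κ', K, hb, hκ', hrem⟩ := (h i).exists_bstep_annotated hκ
    exact ⟨κ', hκ', K, hb, hrem⟩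
  choose K hK using hR
  exact ⟨κ, K, hκ, hK⟩

theorem exists_reversible_trace {n : ℕ} {A : Fin (n + 1) → CProc} {K : Fin n → Set Key}
    {ζ : Fin n → BLabel} {X₀ : RProc} {κ₀ : Causes} (hA : A 0 = X₀.toC κ₀)
    (h : ∀ i : Fin n, BStep (A i.castSucc) (K i) (ζ i) (A i.succ)) (h₀ : X₀.Annotated κ₀)
    (hkeys : X₀.keys ⊆ (X₀.toC κ₀).keys) :
    ∃ (X : Fin (n + 1) → RProc) (κ : Fin (n + 1) → Causes) (μ : Fin n → FLabel), X 0 = X₀ ∧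
      (∀ i, A i = (X i).toC (κ i)) ∧ ∀ i : Fin n, FStep (X i.castSucc) (μ i) (X i.succ) ∧
        ζ i = gamma (μ i) ∧
        (X i.succ).Rem (μ i).key ((X i.succ).structCauses (μ i).key) = K i := by
  obtain ⟨N, hN⟩ := exists_key_bound ζ
  obtain ⟨f, hf, hS, hR⟩ := exists_fin_seq (a := (X₀, κ₀))
    (fun i p => A i = p.1.toC p.2 ∧ p.1.Annotated p.2 ∧ p.1.HiddenKeysFrom N p.2)
    (fun i p q => ∃ μ, FStep p.1 μ q.1 ∧ ζ i = gamma μ ∧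
      q.1.Rem μ.key (q.1.structCauses μ.key) = K i)
    ⟨hA, h₀, fun k hk => .inl (hkeys hk)⟩ fun i p ⟨hAp, hp, hpN⟩ => by
      obtain ⟨X', κ', μ, hA', hs, hγ, hX', hN', hrem⟩ :=
        BStep.exists_fstep_annotated (hAp ▸ h i) hp hpN (hN i)
      exact ⟨(X', κ'), ⟨hA'.symm, hX', hN'⟩, μ, hs, hγ.symm, hrem⟩
  choose μ hμ using hR
  exact ⟨fun i => (f i).1, fun i => (f i).2, μ, congrArg Prod.fst hf, fun i => (hS i).1, hμ⟩

end PiCausal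

theorem mainTheorem3 (P : Proc Atom) (hP : P.BoundDistinct) (n : ℕ) :
    (∀ (A : Fin (n + 1) → CProc) (KB : Fin n → Set Key) (ζ : Fin n → BLabel),
      A 0 = CProc.ofProc P →
      (∀ i : Fin n, BStep (A i.castSucc) (KB i) (ζ i) (A i.succ)) →
      ∃ (X : Fin (n + 1) → RProc) (KF : Fin n → Multiset Key) (μ : Fin n → FLabel),
        X 0 = RProc.initial P ∧
        (∀ i : Fin n, FStepK (X i.castSucc) (KF i) (μ i) (X i.succ)) ∧
        (∀ i : Fin (n + 1), (A i).erase = (X i).erase) ∧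
        (∀ i : Fin n, ζ i = gamma (μ i)) ∧
        (∀ i : Fin n, (X i.succ).Rem (μ i).key (KF i) = KB i)) ∧
    (∀ (X : Fin (n + 1) → RProc) (KF : Fin n → Multiset Key) (μ : Fin n → FLabel),
      X 0 = RProc.initial P →
      (∀ i : Fin n, FStepK (X i.castSucc) (KF i) (μ i) (X i.succ)) →
      ∃ (A : Fin (n + 1) → CProc) (KB : Fin n → Set Key) (ζ : Fin n → BLabel),
        A 0 = CProc.ofProc P ∧
        (∀ i : Fin n, BStep (A i.castSucc) (KB i) (ζ i) (A i.succ)) ∧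
        (∀ i : Fin (n + 1), (A i).erase = (X i).erase) ∧
        (∀ i : Fin n, ζ i = gamma (μ i)) ∧
        (∀ i : Fin n, (X i.succ).Rem (μ i).key (KF i) = KB i)) := by
  have h₀ : (RProc.initial P).Annotated fun _ => ∅ := RProc.annotated_initial hP _
  constructor
  · intro A KB ζ hA hA'
    obtain ⟨X, κ, μ, hX, hAX, hstep⟩ := exists_reversible_trace
      (hA.trans (RProc.toC_initial P _).symm) hA' h₀
      ((RProc.keys_initial P).subset.trans (Set.empty_subset _))
    exact ⟨X, _, μ, hX, fun i => ⟨(hstep i).1, rfl⟩,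
      fun i => hAX i ▸ (X i).erase_toC (κ i), fun i => (hstep i).2.1, fun i => (hstep i).2.2⟩
  · intro X KF μ hX hX'
    obtain ⟨κ, K, -, hstep⟩ := exists_causal_trace (hX ▸ h₀) fun i => (hX' i).1
    exact ⟨fun i => (X i).toC (κ i), K, _, by simp only [hX, RProc.toC_initial],
      fun i => (hstep i).1, fun i => (X i).erase_toC (κ i), fun _ => rfl,
      fun i => (hX' i).2 ▸ (hstep i).2⟩
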